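/- Let $R$ be an alternative ring (not necessarily with unit, i.e. a possibly non-unital, possibly non-associative ring in which $(x,y,y)=0=(y,y,x)$ for all $x,y\in R$, where $(x,y,z)=(xy)z-x(yz)$ denotes the associator) which is not associative. A zero divisor of $R$ is a non-zero element $a\in R$ such that $ab=0$ or $ba=0$ for some non-zero $b\in R$. Let $C$ be the center of $R$, that is, the set of all $c\in R$ with $(c,R,R)=0$ and $cx=xc$ for all $x\in R$. Assume that no non-zero associator $(x,y,z)$ of $R$ is a zero divisor. Then: (a) $R$ contains no zero divisors. (b) If, in addition, the characteristic of $R$ (the least positive integer $n$ with $nR=0$, or $0$ if there is none) is not $2$, then $C\neq 0$, and the central quotient ring $R//C$ (the ring of fractions $r/c$ with $r\in R$ and $0\neq c\in C$, where $r/c=s/d$ if and only if $dr=cs$, with the usual addition and multiplication of fractions) has as its center the fraction field $F=\{c/d : c,d\in C,\ d\neq 0\}$ of $C$, and $R//C$ is an $8$-dimensional octonion division algebra over $F$. Here an octonion algebra over a field $F$ is a unital, not necessarily associative $F$-algebra of dimension $8$ carrying a multiplicative quadratic form whose polar bilinear form is nondegenerate, and it is a division algebra if for all $a\neq 0$ and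 all $b$ the equations $ax=b$ and $ya=b$ have unique solutions. -/

import Mathlib

/-- A (not necessarily unital or associative) ring is alternative if
`(x, y, y) = 0 = (y, y, x)` for all `x, y`. -/
def IsAlternative (R : Type*) [NonUnitalNonAssocRing R] : Prop :=
  ∀ x y : R, associator x y y = 0 ∧ associator y y x = 0

/-- A zero divisor: a non-zero element that is a left or a right zero divisor. -/
def IsZeroDivisor {R : Type*} [NonUnitalNonAssocRing R] (a : R) : Prop :=
  a ≠ 0 ∧ ((∃ b : R, b ≠ 0 ∧ a * b = 0) ∨ (∃ b : R, b ≠ 0 ∧ b * a = 0))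

/-- The characteristic of a ring without a unit element: the least positive `n` with `n • x = 0`
for all `x`, and `0` if there is none. -/
noncomputable def nonUnitalRingChar (R : Type*) [NonUnitalNonAssocRing R] : ℕ :=
  AddMonoid.exponent R

/-- In an alternative ring, the center (in the sense of Mathlib) consists of the
elements `c` with `(c, R, R) = 0` that commute with all elements. -/
theorem IsAlternative.mem_center_iff {R : Type*} [NonUnitalNonAssocRing R]
    (hR : IsAlternative R) (c : R) :
    c ∈ NonUnitalSubring.center R ↔
      (∀ y z : R, associator c y z = 0) ∧ ∀ x : R, c * x - x * c = 0 := by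
  have h1 : ∀ x y z : R, associator x y z = - associator x z y := by
    intro x y z
    have h := (hR x (y + z)).1
    have hy := (hR x y).1
    have hz := (hR x z).1
    simp only [associator, mul_add, add_mul] at *
    rw [eq_neg_iff_add_eq_zero]
    have : (x * y * z - x * (y * z)) + (x * z * y - x * (z * y)) =
      (x * y * y + x * z * y + (x * y * z + x * z * z) -
        (x * (y * y) + x * (z * y) + (x * (y * z) + x * (z * z))))
        - (x * y * y - x * (y * y)) - (x * z * z - x * (z * z)) := by abel
    rw [this, h, hy, hz]; simp
  have h2 : ∀ x y z : R, associator x y z = - associator y x z := by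
    intro x y z
    have h := (hR z (x + y)).2
    have hx := (hR z x).2
    have hy := (hR z y).2
    simp only [associator, mul_add, add_mul] at *
    rw [eq_neg_iff_add_eq_zero]
    have : (x * y * z - x * (y * z)) + (y * x * z - y * (x * z)) =
      (x * x * z + y * x * z + (x * y * z + y * y * z) -
        (x * (x * z) + y * (x * z) + (x * (y * z) + y * (y * z))))
        - (x * x * z - x * (x * z)) - (y * y * z - y * (y * z)) := by abel
    rw [this, h, hx, hy]; simp
  constructor
  · intro h
    have h : IsMulCentral c := h
    exact ⟨fun y z => by rw [associator, h.left_assoc, sub_self],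
      fun x => by rw [(h.comm x).eq, sub_self]⟩
  · rintro ⟨ha, hc⟩
    have h : IsMulCentral c :=
      { comm := fun x => sub_eq_zero.mp (hc x)
        left_assoc := fun y z => (sub_eq_zero.mp (ha y z)).symm
        right_assoc := fun y z => by
          have : associator y z c = 0 := by rw [h1, h2, ha]; simp
          exact sub_eq_zero.mp this }
    exact h

/-! ### The central quotient ring -/

namespace CentralQuotient

variable (R : Type*) [NonUnitalNonAssocRing R]

/-- The denominators: the non-zero elements of the center. -/
abbrev Denom : Type _ := {c : NonUnitalSubring.center R // c ≠ 0}

variable {R}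

/-- Multiplication by a central element, as an additive map (used only in proofs). -/
abbrev cmul (c : NonUnitalSubring.center R) : R →+ R := AddMonoidHom.mulLeft (c : R)

theorem central (c : NonUnitalSubring.center R) : IsMulCentral (c : R) := c.2

theorem coe_mul' (c : NonUnitalSubring.center R) (r : R) : (c : R) * r = cmul c r := rfl

theorem cmul_mul (c : NonUnitalSubring.center R) (r s : R) : cmul c r * s = cmul c (r * s) :=
  ((central c).left_assoc r s).symm

theorem mul_cmul (c : NonUnitalSubring.center R) (r s : R) : r * cmul c s = cmul c (r * s) := by
  change r * (c * s) = c * (r * s)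
  rw [← (central c).mid_assoc, ← ((central c).comm r).eq, ← (central c).left_assoc]

theorem cmul_cmul (c d : NonUnitalSubring.center R) (r : R) :
    cmul (c * d) r = cmul c (cmul d r) :=
  ((central c).left_assoc (d : R) r).symm

theorem cmul_comm (c d : NonUnitalSubring.center R) (r : R) :
    cmul c (cmul d r) = cmul d (cmul c r) := by
  rw [← cmul_cmul, mul_comm, cmul_cmul]

theorem cmul_coe (c d : NonUnitalSubring.center R) :
    cmul c (d : R) = ((c * d : NonUnitalSubring.center R) : R) := rfl

variable [NoZeroDivisors R]

theorem cmul_cancel (c : Denom R) {r s : R} (h : cmul c.1 r = cmul c.1 s) : r = s := by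
  have h' : ((c.1 : R)) * (r - s) = 0 := by
    rw [mul_sub]; exact sub_eq_zero.mpr h
  rcases mul_eq_zero.mp h' with h0 | h0
  · exact absurd (Subtype.ext h0) c.2
  · exact sub_eq_zero.mp h0

/-- The product of two denominators. -/
def Denom.mul (c d : Denom R) : Denom R :=
  ⟨c.1 * d.1, fun h => by
    have h' : (c.1 : R) * (d.1 : R) = 0 := congrArg Subtype.val h
    rcases mul_eq_zero.mp h' with h0 | h0
    · exact c.2 (Subtype.ext h0)
    · exact d.2 (Subtype.ext h0)⟩

theorem cmul_denom_mul (c d : Denom R) (r : R) :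
    cmul (c.mul d).1 r = cmul c.1 (cmul d.1 r) := cmul_cmul c.1 d.1 r

variable (R)

/-- Two pairs `(r, c)` and `(s, d)` define the same fraction if `d r = c s`. -/
def setoid : Setoid (R × Denom R) where
  r p q := (q.2.1 : R) * p.1 = (p.2.1 : R) * q.1
  iseqv :=
    { refl := fun _ => rfl
      symm := fun h => h.symm
      trans := by
        rintro ⟨r, c⟩ ⟨s, d⟩ ⟨t, e⟩ h1 h2
        simp only [coe_mul'] at *
        apply cmul_cancel d
        rw [cmul_comm, h1, cmul_comm, h2, cmul_comm] }

end CentralQuotient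

/-- The central quotient ring `R//C` of a ring `R` without zero divisors, with center `C`:
the fractions `r/c` with `r ∈ R` and `0 ≠ c ∈ C`, where `r/c = s/d` means `d r = c s`. -/
def CentralQuotient (R : Type*) [NonUnitalNonAssocRing R] [NoZeroDivisors R] : Type _ :=
  Quotient (CentralQuotient.setoid R)

namespace CentralQuotient

variable {R : Type*} [NonUnitalNonAssocRing R] [NoZeroDivisors R]

/-- The fraction `r/c`. -/
def mk (r : R) (c : Denom R) : CentralQuotient R := Quotient.mk (setoid R) (r, c)

theorem mk_eq_mk {r s : R} {c d : Denom R} :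
    mk r c = mk s d ↔ (d.1 : R) * r = (c.1 : R) * s :=
  Quotient.eq (r := setoid R)

theorem mk_eq_mk' {r s : R} {c d : Denom R} : mk r c = mk s d ↔ cmul d.1 r = cmul c.1 s :=
  mk_eq_mk

theorem ind {p : CentralQuotient R → Prop} (h : ∀ r c, p (mk r c)) (q : CentralQuotient R) : p q :=
  Quotient.ind (fun x => h x.1 x.2) q

/-- `r/c + s/d = (d r + c s)/(c d)`. -/
instance : Add (CentralQuotient R) where
  add := Quotient.map₂
    (fun p q => ((q.2.1 : R) * p.1 + (p.2.1 : R) * q.1, p.2.mul q.2)) (by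
      rintro ⟨r, c⟩ ⟨r', c'⟩ h ⟨s, d⟩ ⟨s', d'⟩ h'
      change cmul c'.1 r = cmul c.1 r' at h
      change cmul d'.1 s = cmul d.1 s' at h'
      change cmul (c'.mul d').1 (cmul d.1 r + cmul c.1 s) =
        cmul (c.mul d).1 (cmul d'.1 r' + cmul c'.1 s')
      simp only [cmul_denom_mul, map_add]
      congr 1
      · rw [cmul_comm d'.1 d.1, cmul_comm c'.1 d.1, cmul_comm c'.1 d'.1, h, cmul_comm d'.1 c.1,
          cmul_comm c.1 d.1]
      · rw [cmul_comm d'.1 c.1, h', cmul_comm c'.1 c.1, cmul_comm c'.1 d.1])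

/-- `- (r/c) = (-r)/c`. -/
instance : Neg (CentralQuotient R) where
  neg := Quotient.map (fun p => (-p.1, p.2)) (by
      rintro ⟨r, c⟩ ⟨r', c'⟩ h
      change cmul c'.1 r = cmul c.1 r' at h
      change cmul c'.1 (-r) = cmul c.1 (-r')
      rw [map_neg, map_neg, h])

/-- `(r/c) (s/d) = (r s)/(c d)`. -/
instance : Mul (CentralQuotient R) where
  mul := Quotient.map₂ (fun p q => (p.1 * q.1, p.2.mul q.2)) (by
      rintro ⟨r, c⟩ ⟨r', c'⟩ h ⟨s, d⟩ ⟨s', d'⟩ h'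
      change cmul c'.1 r = cmul c.1 r' at h
      change cmul d'.1 s = cmul d.1 s' at h'
      change cmul (c'.mul d').1 (r * s) = cmul (c.mul d).1 (r' * s')
      rw [cmul_denom_mul, cmul_denom_mul, ← mul_cmul, ← cmul_mul, h, h', cmul_mul, mul_cmul])

theorem mk_add_mk (r s : R) (c d : Denom R) :
    mk r c + mk s d = mk (cmul d.1 r + cmul c.1 s) (c.mul d) := rfl

theorem neg_mk (r : R) (c : Denom R) : - mk r c = mk (-r) c := rfl

theorem mk_mul_mk (r s : R) (c d : Denom R) : mk r c * mk s d = mk (r * s) (c.mul d) := rfl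

variable [Nontrivial (NonUnitalSubring.center R)]

/-- Some denominator. -/
noncomputable def someDenom (R : Type*) [NonUnitalNonAssocRing R]
    [Nontrivial (NonUnitalSubring.center R)] : Denom R :=
  ⟨(exists_ne 0).choose, (exists_ne 0).choose_spec⟩

/-- `0 = 0/c`, for any denominator `c`. -/
noncomputable instance : Zero (CentralQuotient R) := ⟨mk 0 (someDenom R)⟩

/-- `1 = c/c`, for any denominator `c`. -/
noncomputable instance : One (CentralQuotient R) := ⟨mk ((someDenom R).1 : R) (someDenom R)⟩

theorem zero_def : (0 : CentralQuotient R) = mk 0 (someDenom R) := rfl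

theorem one_def : (1 : CentralQuotient R) = mk ((someDenom R).1 : R) (someDenom R) := rfl

theorem mk_eq_zero {r : R} {c : Denom R} : mk r c = 0 ↔ r = 0 := by
  rw [zero_def, mk_eq_mk', map_zero]
  exact ⟨fun h => cmul_cancel (someDenom R) (by rw [h, map_zero]), fun h => by rw [h, map_zero]⟩

theorem mk_coe_self (c : Denom R) : mk (c.1 : R) c = 1 := by
  rw [one_def, mk_eq_mk', cmul_coe, cmul_coe, mul_comm]

noncomputable instance : NonAssocRing (CentralQuotient R) where
  add_assoc a b c := by
    induction a using ind; induction b using ind; induction c using ind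
    simp only [mk_add_mk, mk_eq_mk', cmul_denom_mul, map_add, cmul_comm, add_assoc]
  zero_add a := by
    induction a using ind
    simp only [zero_def, mk_add_mk, mk_eq_mk', cmul_denom_mul, map_zero, zero_add, cmul_comm]
  add_zero a := by
    induction a using ind
    simp only [zero_def, mk_add_mk, mk_eq_mk', cmul_denom_mul, map_zero, add_zero]
  add_comm a b := by
    induction a using ind; induction b using ind
    simp only [mk_add_mk, mk_eq_mk', cmul_denom_mul, map_add, cmul_comm]
    rw [add_comm]
  neg_add_cancel a := by
    induction a using ind
    rw [neg_mk, mk_add_mk, mk_eq_zero, map_neg, neg_add_cancel]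
  nsmul := nsmulRec
  zsmul := zsmulRec
  left_distrib a b c := by
    induction a using ind; induction b using ind; induction c using ind
    simp only [mk_add_mk, mk_mul_mk, mk_eq_mk', cmul_denom_mul, map_add, mul_add, mul_cmul,
      cmul_comm]
  right_distrib a b c := by
    induction a using ind; induction b using ind; induction c using ind
    simp only [mk_add_mk, mk_mul_mk, mk_eq_mk', cmul_denom_mul, map_add, add_mul, cmul_mul,
      cmul_comm]
  zero_mul a := by
    induction a using ind
    rw [zero_def, mk_mul_mk, zero_mul, mk_eq_zero.mpr rfl, zero_def]
  mul_zero a := by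
    induction a using ind
    rw [zero_def, mk_mul_mk, mul_zero, mk_eq_zero.mpr rfl, zero_def]
  one_mul a := by
    induction a using ind
    rw [one_def, mk_mul_mk, mk_eq_mk', coe_mul', cmul_denom_mul, cmul_comm]
  mul_one a := by
    induction a using ind with | _ r c
    have : r * ((someDenom R).1 : R) = cmul (someDenom R).1 r :=
      ((central (someDenom R).1).comm r).eq.symm
    rw [one_def, mk_mul_mk, mk_eq_mk', this, cmul_denom_mul]

theorem mk_mem_center (c : NonUnitalSubring.center R) (d : Denom R) :
    mk (c : R) d ∈ NonUnitalSubring.center (CentralQuotient R) := by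
  have h : IsMulCentral (mk (c : R) d) :=
    { comm := fun a => by
        induction a using ind with | _ r e
        change mk _ _ * mk _ _ = mk _ _ * mk _ _
        rw [mk_mul_mk, mk_mul_mk, mk_eq_mk', ← ((central c).comm r).eq, cmul_denom_mul,
          cmul_denom_mul, cmul_comm]
      left_assoc := fun a b => by
        induction a using ind; induction b using ind
        simp only [mk_mul_mk, mk_eq_mk', (central c).left_assoc, cmul_denom_mul, cmul_comm]
      right_assoc := fun a b => by
        induction a using ind; induction b using ind
        simp only [mk_mul_mk, mk_eq_mk', (central c).right_assoc, cmul_denom_mul, cmul_comm] }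
  exact h

end CentralQuotient

open CentralQuotient in
/-- The set of fractions `c/d` with `c, d ∈ C`, `d ≠ 0`, as a subring of `R//C`. -/
def centerFractions (R : Type*) [NonUnitalNonAssocRing R] [NoZeroDivisors R]
    [Nontrivial (NonUnitalSubring.center R)] : NonUnitalSubring (CentralQuotient R) where
  carrier := {q | ∃ (c : NonUnitalSubring.center R) (d : Denom R), q = mk (c : R) d}
  zero_mem' := ⟨0, someDenom R, rfl⟩
  add_mem' := by
    rintro _ _ ⟨c, d, rfl⟩ ⟨c', d', rfl⟩
    exact ⟨d'.1 * c + d.1 * c', d.mul d', rfl⟩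
  neg_mem' := by
    rintro _ ⟨c, d, rfl⟩
    exact ⟨-c, d, rfl⟩
  mul_mem' := by
    rintro _ _ ⟨c, d, rfl⟩ ⟨c', d', rfl⟩
    exact ⟨c * c', d.mul d', rfl⟩

/-- The fraction field of the center `C` of `R`: the fractions `c/d` with `c, d ∈ C`, `d ≠ 0`,
where `c/d = c'/d'` means `d' c = d c'`. -/
def CenterFractionField (R : Type*) [NonUnitalNonAssocRing R] [NoZeroDivisors R]
    [Nontrivial (NonUnitalSubring.center R)] : Type _ :=
  centerFractions R

namespace CenterFractionField

open CentralQuotient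

variable {R : Type*} [NonUnitalNonAssocRing R] [NoZeroDivisors R]
  [Nontrivial (NonUnitalSubring.center R)]

noncomputable instance : NonUnitalNonAssocRing (CenterFractionField R) :=
  inferInstanceAs (NonUnitalNonAssocRing (centerFractions R))

noncomputable instance : One (CenterFractionField R) :=
  ⟨⟨1, (someDenom R).1, someDenom R, rfl⟩⟩

theorem isMulCentral (a : CenterFractionField R) : IsMulCentral (a.1 : CentralQuotient R) := by
  obtain ⟨_, c, d, rfl⟩ := a
  exact mk_mem_center c d

theorem exists_inv (a : CenterFractionField R) (ha : a ≠ 0) :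
    ∃ b : CenterFractionField R, a * b = 1 := by
  obtain ⟨_, c, d, rfl⟩ := a
  have hc : c ≠ 0 := by
    rintro rfl
    exact ha (Subtype.ext (mk_eq_zero.mpr rfl))
  refine ⟨⟨mk (d.1 : R) ⟨c, hc⟩, d.1, ⟨c, hc⟩, rfl⟩, Subtype.ext ?_⟩
  change mk (c : R) d * mk (d.1 : R) ⟨c, hc⟩ = 1
  rw [mk_mul_mk, ← mk_coe_self (d.mul ⟨c, hc⟩)]
  congr 1
  exact ((central c).comm _).eq

open Classical in
noncomputable instance : Field (CenterFractionField R) where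
  __ := (inferInstance : NonUnitalNonAssocRing (CenterFractionField R))
  one_mul a := Subtype.ext (one_mul a.1)
  mul_one a := Subtype.ext (mul_one a.1)
  mul_assoc a b c := Subtype.ext ((isMulCentral a).left_assoc b.1 c.1).symm
  mul_comm a b := Subtype.ext ((isMulCentral a).comm b.1)
  inv a := if h : a ≠ 0 then (exists_inv a h).choose else 0
  exists_pair_ne := ⟨0, 1, fun h => by
    have h1 : mk ((someDenom R).1 : R) (someDenom R) = 0 := (congrArg Subtype.val h).symm
    exact (someDenom R).2 (Subtype.ext (mk_eq_zero.mp h1))⟩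
  mul_inv_cancel a ha := by
    change a * (if h : a ≠ 0 then (exists_inv a h).choose else 0) = 1
    rw [dif_pos ha]
    exact (exists_inv a ha).choose_spec
  inv_zero := dif_neg (fun h => h rfl)
  nnqsmul := _
  qsmul := _

/-- The scalar action `(c/d) • (r/e) = (c/d) (r/e)`. -/
noncomputable instance : Module (CenterFractionField R) (CentralQuotient R) where
  smul a q := a.1 * q
  one_smul q := one_mul q
  mul_smul a b q := ((isMulCentral a).left_assoc b.1 q).symm
  smul_zero a := mul_zero a.1
  smul_add a := mul_add a.1
  add_smul a b := add_mul a.1 b.1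
  zero_smul q := zero_mul q

theorem smul_def (a : CenterFractionField R) (q : CentralQuotient R) : a • q = a.1 * q := rfl

instance : IsScalarTower (CenterFractionField R) (CentralQuotient R) (CentralQuotient R) :=
  ⟨fun a p q => ((isMulCentral a).left_assoc p q).symm⟩

instance : SMulCommClass (CenterFractionField R) (CentralQuotient R) (CentralQuotient R) :=
  ⟨fun a p q => by
    change a.1 * (p * q) = p * (a.1 * q)
    rw [(isMulCentral a).left_assoc, (isMulCentral a).comm, (isMulCentral a).mid_assoc]⟩

end CenterFractionField

/-- A composition algebra over a field `F`: a unital, not necessarily associative algebra with a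
quadratic form that is multiplicative and has a nondegenerate polar bilinear form. -/
def IsCompositionAlgebra (F A : Type*) [Field F] [NonAssocRing A] [Module F A]
    [IsScalarTower F A A] [SMulCommClass F A A] : Prop :=
  ∃ N : QuadraticForm F A,
    (∀ x y : A, N (x * y) = N x * N y) ∧ (QuadraticMap.polarBilin N).Nondegenerate

/-- An octonion algebra: an 8-dimensional composition algebra. -/
structure IsOctonionAlgebra (F A : Type*) [Field F] [NonAssocRing A] [Module F A]
    [IsScalarTower F A A] [SMulCommClass F A A] : Prop where
  finrank_eq : Module.finrank F A = 8
  isComposition : IsCompositionAlgebra F A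

/-- An octonion division algebra: an octonion algebra in which the equations `a x = b` and
`y a = b` with `a ≠ 0` are uniquely solvable. -/
structure IsOctonionDivisionAlgebra (F A : Type*) [Field F] [NonAssocRing A] [Module F A]
    [IsScalarTower F A A] [SMulCommClass F A A] : Prop extends IsOctonionAlgebra F A where
  existsUnique_mul_left : ∀ a b : A, a ≠ 0 → ∃! x : A, a * x = b
  existsUnique_mul_right : ∀ a b : A, a ≠ 0 → ∃! y : A, y * a = b

/-!
Write `(x, y, z)` for the associator and `[x, y]` for the commutator.

*No zero divisors.* Suppose `a b = 0` with `a ≠ 0`. The Moufang identity `(a, a b, z) = (a, b, z) a`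
and the regularity of associators give `(a, b, z) = 0`, so the right annihilator of `a` is closed
under right multiplication. Hence `a (b, y, z) = 0`, so that everything annihilated by `a`, in
particular `b` and `b x`, is nuclear. Then `b (x, y, z) = (b x, y, z) = 0` for all `x, y, z`, and
`b = 0` because `R` is not associative (`IsAlternative.eq_zero_or_eq_zero_of_mul_eq_zero`).

*Central elements.* In a non-associative alternative ring without zero divisors the nucleus is the
center (`IsAlternative.commute_of_nuclear`). The commutator `u = [x, y]` anticommutes with
`(x, y, z)`, and from this it follows that `u²` commutes and associates with `x` and `y` as soon as
some `(x, y, z)` is non-zero. An element that commutes and associates with two non-commuting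
elements is nuclear (`IsAlternative.nuclear_of_commute`), so `u²` is central. If `2` is regular,
every non-central `a` has a partner `b` with `[a, b] ≠ 0` that does not associate with `a`; in
particular the center is non-zero.

*The quadratic equation.* In the central quotient, which satisfies the same hypotheses and whose
center is the fraction field `F`, put `u = [a, b]` with `b` as above. Then `a u = [a, a b]` and
`u + a u = [a, b + a b]`, so `u`, `a u` and `u + a u` have squares in `F`. This yields
`a u + u a = t u` with `t ∈ F`, whence `(a u)² = (t a - a²) u²` and `a² - t a ∈ F`
(`IsAlternative.exists_quadratic_equation`).

*Octonions.* In a quadratic alternative algebra without zero divisors over a field in which `2` is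
invertible, the elements with scalar square that are not non-zero scalars form, together with `0`,
a complement of the scalars. The resulting conjugation is an involution and `a ā` is a
multiplicative anisotropic quadratic form, which makes the algebra a composition and a division
algebra. Orthogonalizing the entries of a non-zero associator gives eight orthogonal elements
`1, x, y, z, xy, yz, zx, (xy)z`. A further element `w` orthogonal to these would satisfy
`x (y (z w)) = ((x y) z) w` and `x (y (z w)) = -((x y) z) w`
(`IsAlternative.eq_zero_of_anticommute`), so the eight elements form a basis.
-/

/-! ### Identities in alternative rings -/

section Associator

variable {R : Type*} [NonUnitalNonAssocRing R]

theorem associator_add_left (x x' y z : R) :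
    associator (x + x') y z = associator x y z + associator x' y z := by
  simp only [associator, add_mul]; abel

theorem associator_add_middle (x y y' z : R) :
    associator x (y + y') z = associator x y z + associator x y' z := by
  simp only [associator, add_mul, mul_add]; abel

theorem associator_add_right (x y z z' : R) :
    associator x y (z + z') = associator x y z + associator x y z' := by
  simp only [associator, mul_add]; abel

theorem associator_sub_left (x x' y z : R) :
    associator (x - x') y z = associator x y z - associator x' y z := by
  simp only [associator, sub_mul]; abel

theorem associator_sub_middle (x y y' z : R) :
    associator x (y - y') z = associator x y z - associator x y' z := by
  simp only [associator, sub_mul, mul_sub]; abel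

theorem associator_sub_right (x y z z' : R) :
    associator x y (z - z') = associator x y z - associator x y z' := by
  simp only [associator, mul_sub]; abel

/-- The Bruck–Kleinfeld function of four variables. In an alternative ring it is alternating,
although its definition is visibly so in the last two variables only. -/
def kleinfeldFunction (w x y z : R) : R :=
  associator (w * x) y z - x * associator w y z - associator x y z * w

end Associator

namespace IsAlternative

variable {R : Type*} [NonUnitalNonAssocRing R]

theorem associator_swap_right (hR : IsAlternative R) (x y z : R) :
    associator x y z = -associator x z y := by
  have h := (hR x (y + z)).1
  rw [associator_add_right, associator_add_middle, associator_add_middle, (hR x y).1,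
    (hR x z).1] at h
  linear_combination (norm := abel) h

theorem associator_swap_left (hR : IsAlternative R) (x y z : R) :
    associator x y z = -associator y x z := by
  have h := (hR z (x + y)).2
  rw [associator_add_left, associator_add_middle, associator_add_middle, (hR z x).2,
    (hR z y).2] at h
  linear_combination (norm := abel) h

theorem associator_cycle (hR : IsAlternative R) (x y z : R) :
    associator x y z = associator y z x := by
  rw [hR.associator_swap_left, hR.associator_swap_right, neg_neg]

theorem flexible (hR : IsAlternative R) (x y : R) : associator x y x = 0 := by
  rw [hR.associator_cycle, (hR y x).1]

/-- The sum of two consecutive instances of `associator_cocycle`. The sign is that of the cyclic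
shift of four variables, an odd permutation. -/
theorem kleinfeldFunction_cycle (hR : IsAlternative R) (w x y z : R) :
    kleinfeldFunction w x y z = -kleinfeldFunction z w x y := by
  have h1 := associator_cocycle w x y z
  have h2 := associator_cocycle x y z w
  rw [hR.associator_cycle w (x * y), ← hR.associator_cycle (y * z) w x] at h1
  rw [hR.associator_cycle x (y * z), ← hR.associator_cycle (z * w) x y] at h2
  simp only [kleinfeldFunction]
  rw [hR.associator_cycle w y z, hR.associator_cycle z x y]
  linear_combination (norm := abel) -h1 - h2

theorem kleinfeldFunction_swap (hR : IsAlternative R) (w x y z : R) :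
    kleinfeldFunction w x y z = -kleinfeldFunction w x z y := by
  simp only [kleinfeldFunction]
  rw [hR.associator_swap_right (w * x), hR.associator_swap_right w y z,
    hR.associator_swap_right x y z, mul_neg, neg_mul]
  abel

theorem kleinfeldFunction_shift_two (hR : IsAlternative R) (w x y z : R) :
    kleinfeldFunction w x y z = kleinfeldFunction y z w x := by
  rw [hR.kleinfeldFunction_cycle, hR.kleinfeldFunction_cycle z, neg_neg]

theorem kleinfeldFunction_swap_left (hR : IsAlternative R) (w x y z : R) :
    kleinfeldFunction w x y z = -kleinfeldFunction x w y z := by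
  rw [hR.kleinfeldFunction_shift_two, hR.kleinfeldFunction_swap, hR.kleinfeldFunction_shift_two]

theorem kleinfeldFunction_self_left (hR : IsAlternative R) (x y z : R) :
    kleinfeldFunction x x y z = 0 := by
  rw [hR.kleinfeldFunction_shift_two]
  simp only [kleinfeldFunction, (hR _ x).1, mul_zero, zero_mul, sub_zero]

theorem kleinfeldFunction_self_middle (hR : IsAlternative R) (x y z : R) :
    kleinfeldFunction y x x z = 0 := by
  rw [hR.kleinfeldFunction_cycle]
  simp only [kleinfeldFunction, (hR _ x).1, mul_zero, zero_mul, sub_zero, neg_zero]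

theorem kleinfeldFunction_self_odd (hR : IsAlternative R) (x y z : R) :
    kleinfeldFunction x y x z = 0 := by
  rw [hR.kleinfeldFunction_swap_left, hR.kleinfeldFunction_self_middle, neg_zero]

theorem associator_sq (hR : IsAlternative R) (x y z : R) :
    associator (x * x) y z = x * associator x y z + associator x y z * x := by
  have h := hR.kleinfeldFunction_self_left x y z
  simp only [kleinfeldFunction] at h
  linear_combination (norm := abel) h

/-- A form of the Moufang identities. -/
theorem associator_mul_right_self (hR : IsAlternative R) (x y z : R) :
    associator x (x * y) z = associator x y z * x := by
  have h := hR.kleinfeldFunction_self_odd x y z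
  simp only [kleinfeldFunction, (hR _ x).2, mul_zero, sub_zero] at h
  rw [hR.associator_swap_left, hR.associator_swap_left x y, neg_mul]
  linear_combination (norm := abel) -h

/-- A form of the Moufang identities. -/
theorem associator_mul_left_self (hR : IsAlternative R) (x y z : R) :
    associator x (y * x) z = x * associator x y z := by
  have h := hR.kleinfeldFunction_self_middle x y z
  simp only [kleinfeldFunction, (hR _ x).2, zero_mul, sub_zero] at h
  rw [hR.associator_swap_left, hR.associator_swap_left x y, mul_neg]
  linear_combination (norm := abel) -h

theorem associator_self_mul_third (hR : IsAlternative R) (x y z : R) :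
    associator x y (x * z) = associator x y z * x := by
  rw [hR.associator_swap_right, hR.associator_mul_right_self, hR.associator_swap_right x y,
    neg_mul]

theorem associator_mul_self_third (hR : IsAlternative R) (x y z : R) :
    associator x y (z * x) = x * associator x y z := by
  rw [hR.associator_swap_right, hR.associator_mul_left_self, hR.associator_swap_right x y,
    mul_neg]

theorem associator_second_mul_third (hR : IsAlternative R) (x y z : R) :
    associator x y (y * z) = associator x y z * y := by
  rw [hR.associator_swap_left, hR.associator_self_mul_third, hR.associator_swap_left x y,
    neg_mul]

theorem associator_mul_second_third (hR : IsAlternative R) (x y z : R) :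
    associator x y (z * y) = y * associator x y z := by
  rw [hR.associator_swap_left, hR.associator_mul_self_third, hR.associator_swap_left x y,
    mul_neg]

theorem left_alternative (hR : IsAlternative R) (x y : R) : x * (x * y) = x * x * y :=
  (sub_eq_zero.mp (hR y x).2).symm

theorem right_alternative (hR : IsAlternative R) (x y : R) : x * y * y = x * (y * y) :=
  sub_eq_zero.mp (hR x y).1

theorem mul_mul_self (hR : IsAlternative R) (x y : R) : x * y * x = x * (y * x) :=
  sub_eq_zero.mp (hR.flexible x y)

/-- The middle Moufang identity. -/
theorem middle_moufang (hR : IsAlternative R) (x y z : R) :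
    x * y * (z * x) = x * (y * z) * x := by
  have h := hR.associator_mul_self_third x y z
  have h' := hR.mul_mul_self x (y * z)
  rw [hR.associator_cycle x y z, associator_apply, associator_apply y z x, mul_sub] at h
  linear_combination (norm := abel) h - h'

/-- Each value of `kleinfeldFunction` is a sum of two associators, each with a commutator as an
entry. The skew-symmetry gives formulas for two and for three times the value; the difference is
taken so as not to divide. -/
theorem kleinfeldFunction_eq (hR : IsAlternative R) (w x y z : R) :
    kleinfeldFunction w x y z =
      associator (w * x - x * w) y z + associator (y * z - z * y) w x := by
  have h1 := hR.kleinfeldFunction_swap_left w x y z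
  have h2 := hR.kleinfeldFunction_swap_left y z w x
  have h3 := hR.kleinfeldFunction_shift_two w x y z
  have h4 := hR.kleinfeldFunction_cycle x y z w
  have h5 := associator_cocycle w x y z
  rw [hR.associator_cycle w (x * y), ← hR.associator_cycle (y * z) w x] at h5
  simp only [kleinfeldFunction, associator_sub_left] at *
  rw [hR.associator_cycle y w x, hR.associator_cycle z w x] at h2 h3
  rw [hR.associator_cycle x z w, hR.associator_cycle z w x, ← hR.associator_cycle w y z] at h4
  linear_combination (norm := abel) h1 + h2 + h3 - h4 + h5

/-- The value of `kleinfeldFunction` at `(x, y, x y, z)`; computing it in other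
orders of the arguments gives the products of `[x, y]` and `(x, y, z)` below. -/
theorem kleinfeldFunction_mul_self (hR : IsAlternative R) (x y z : R) :
    kleinfeldFunction x y (x * y) z = associator x y (associator x y z) := by
  have e : associator y (associator x y z) x = associator x y (associator x y z) :=
    (hR.associator_cycle _ _ _).symm
  rw [kleinfeldFunction, (hR z (x * y)).2, hR.associator_mul_right_self,
    hR.associator_mul_left_self, hR.associator_swap_left y x, ← e,
    associator_apply y (associator x y z)]
  simp only [mul_neg, neg_mul]
  abel

theorem associator_mul_self_self (hR : IsAlternative R) (x y : R) :
    associator (x * y) x y = 0 := by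
  rw [hR.associator_cycle, hR.associator_self_mul_third, (hR x y).1, zero_mul]

/-- With `commutator_mul_associator`, this shows that `[x, y]` and `(x, y, z)` anticommute. -/
theorem associator_mul_commutator (hR : IsAlternative R) (x y z : R) :
    associator x y z * (x * y - y * x) = -associator x y (associator x y z) := by
  have h := hR.kleinfeldFunction_mul_self x y z
  have e1 : associator (x * y * z) x y
      = associator x y z * y * x + associator x y (associator x y z) := by
    have : x * y * z = x * (y * z) + associator x y z := by rw [associator_apply]; abel
    rw [hR.associator_cycle, this, associator_add_right, hR.associator_self_mul_third,
      hR.associator_second_mul_third]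
  have e2 : associator x y z * y * x
      = associator x y z * (y * x) - associator x y (associator x y z) := by
    have h' := hR.associator_swap_right (associator x y z) y x
    rw [hR.associator_cycle (associator x y z) x y, associator_apply (associator x y z) y x] at h'
    linear_combination (norm := abel) h'
  rw [hR.kleinfeldFunction_shift_two, kleinfeldFunction, e1, e2, hR.associator_mul_self_self,
    hR.associator_cycle z x y] at h
  rw [mul_sub]
  linear_combination (norm := (simp only [mul_zero]; abel)) -h

theorem commutator_mul_associator (hR : IsAlternative R) (x y z : R) :
    (x * y - y * x) * associator x y z = associator x y (associator x y z) := by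
  have h := hR.kleinfeldFunction_mul_self x y z
  have e1 : associator (z * (x * y)) x y
      = y * (x * associator x y z) - associator x y (associator x y z) := by
    have : z * (x * y) = z * x * y - associator x y z := by
      rw [← hR.associator_cycle z x y, associator_apply]; abel
    rw [hR.associator_cycle, this, associator_sub_right, hR.associator_mul_second_third,
      hR.associator_mul_self_third]
  have e2 : y * (x * associator x y z)
      = y * x * associator x y z + associator x y (associator x y z) := by
    rw [hR.associator_swap_left x y (associator x y z), associator_apply y x (associator x y z)]
    abel
  rw [hR.kleinfeldFunction_shift_two, hR.kleinfeldFunction_swap_left, kleinfeldFunction, e1, e2,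
    hR.associator_mul_self_self, hR.associator_cycle z x y] at h
  rw [sub_mul]
  linear_combination (norm := (simp only [zero_mul]; abel)) h

theorem commutator_mul_associator_add (hR : IsAlternative R) (x y z : R) :
    (x * y - y * x) * associator x y z + associator x y z * (x * y - y * x) = 0 := by
  rw [hR.commutator_mul_associator, hR.associator_mul_commutator, add_neg_cancel]

theorem associator_commutator_left (hR : IsAlternative R) (x y z : R) :
    associator (x * y - y * x) x z = associator x y (z * x - x * z) := by
  rw [associator_sub_left, associator_sub_right, hR.associator_swap_left,
    hR.associator_mul_right_self, hR.associator_swap_left (y * x), hR.associator_mul_left_self,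
    hR.associator_mul_self_third, hR.associator_self_mul_third]
  abel

theorem associator_sq_commutator_left (hR : IsAlternative R) (x y z : R) :
    associator ((x * y - y * x) * (x * y - y * x)) x z = 0 := by
  rw [hR.associator_sq, hR.associator_commutator_left, hR.commutator_mul_associator_add]

theorem associator_sq_commutator_right (hR : IsAlternative R) (x y z : R) :
    associator ((x * y - y * x) * (x * y - y * x)) y z = 0 := by
  rw [← neg_sub (y * x) (x * y), neg_mul_neg, hR.associator_sq_commutator_left]

end IsAlternative

/-- A group is not the union of two proper subgroups, stated for kernels. -/
theorem AddMonoidHom.eq_zero_or_eq_zero_of_forall {A B C : Type*} [AddGroup A] [AddGroup B]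
    [AddGroup C] (f : A →+ B) (g : A →+ C) (h : ∀ x, f x = 0 ∨ g x = 0) :
    (∀ x, f x = 0) ∨ ∀ x, g x = 0 := by
  by_contra! hne
  obtain ⟨⟨x, hx⟩, y, hy⟩ := hne
  have hgx := (h x).resolve_left hx
  have hfy := (h y).resolve_right hy
  rcases h (x + y) with h' | h'
  · rw [map_add, hfy, add_zero] at h'
    exact hx h'
  · rw [map_add, hgx, zero_add] at h'
    exact hy h'

namespace IsAlternative

variable {R : Type*} [NonUnitalNonAssocRing R]

/-! ### Rings whose non-zero associators are not zero divisors -/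

theorem associator_nuclear_mul {n : R} (hn : ∀ y z, associator n y z = 0) (x y z : R) :
    associator (n * x) y z = n * associator x y z := by
  have h := associator_cocycle n x y z
  rw [hn, hn, hn, zero_mul] at h
  linear_combination (norm := abel) -h

/-- If non-zero associators are regular, then so are all non-zero elements: the right annihilator
of `a ≠ 0` is closed under right multiplication and consists of nuclear elements, and these
annihilate all associators. -/
theorem eq_zero_or_eq_zero_of_mul_eq_zero (hR : IsAlternative R)
    (hna : ∃ x y z : R, associator x y z ≠ 0)
    (hv : ∀ x y z b : R, associator x y z * b = 0 → associator x y z = 0 ∨ b = 0)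
    (hv' : ∀ x y z b : R, b * associator x y z = 0 → associator x y z = 0 ∨ b = 0)
    {a b : R} (hab : a * b = 0) : a = 0 ∨ b = 0 := by
  by_cases h0 : a = 0
  · exact Or.inl h0
  right
  have hassoc : ∀ c, a * c = 0 → ∀ z, associator a c z = 0 := by
    intro c hc z
    have h : associator a c z * a = 0 := by
      rw [← hR.associator_mul_right_self, hc, associator_apply]
      simp only [mul_zero, zero_mul, sub_zero]
    exact (hv _ _ _ _ h).resolve_right h0
  -- The right annihilator of `a` is closed under right multiplication.
  have hright : ∀ c, a * c = 0 → ∀ z, a * (c * z) = 0 := by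
    intro c hc z
    have h := hassoc c hc z
    rw [associator_apply, hc, zero_mul, zero_sub, neg_eq_zero] at h
    exact h
  have hnuc : ∀ c, a * c = 0 → ∀ y z, associator c y z = 0 := by
    intro c hc y z
    have h : a * associator c y z = 0 := by
      rw [associator_apply, mul_sub, hright _ (hright c hc y) z, hright c hc, sub_zero]
    exact (hv' _ _ _ _ h).resolve_right h0
  obtain ⟨x, y, z, hxyz⟩ := hna
  have h : b * associator x y z = 0 := by
    rw [← associator_nuclear_mul (hnuc b hab), hnuc _ (hright b hab x)]
  exact (hv' _ _ _ _ h).resolve_left hxyz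

/-! ### Nucleus and center of an alternative ring without zero divisors -/

theorem commute_associator_of_nuclear (hR : IsAlternative R) {n : R}
    (hn : ∀ y z, associator n y z = 0) (x y z : R) :
    n * associator x y z = associator x y z * n := by
  have h := hR.kleinfeldFunction_shift_two n x y z
  have h1 : associator (y * z) n x = 0 := by rw [hR.associator_cycle, hn]
  have h2 : associator y n x = 0 := by rw [hR.associator_cycle, hn]
  have h3 : associator z n x = 0 := by rw [hR.associator_cycle, hn]
  simp only [kleinfeldFunction, associator_nuclear_mul hn, hn, h1, h2, h3, mul_zero, zero_mul,
    sub_zero] at h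
  exact sub_eq_zero.mp h

/-- If `R` is not associative, its nucleus is its center. The proof shows that
`[n, x] (x, y, z) = [n, x (x, y, z)] = 0` for all nuclear `n`. -/
theorem commute_of_nuclear [NoZeroDivisors R] (hR : IsAlternative R)
    (hna : ∃ x y z : R, associator x y z ≠ 0)
    {n : R} (hn : ∀ y z, associator n y z = 0) (x : R) : n * x - x * n = 0 := by
  have key : ∀ x, (∀ y, AddMonoidHom.associator x y = 0) ∨
      (AddMonoidHom.mulLeft n - AddMonoidHom.mulRight n) x = 0 := by
    intro x
    by_cases h0 : n * x - x * n = 0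
    · exact Or.inr h0
    refine Or.inl fun y => AddMonoidHom.ext fun z => ?_
    have h1 := hR.commute_associator_of_nuclear hn x (y * x) z
    have h2 : associator x (associator x y z) n = 0 := by
      rw [← hR.associator_cycle, hn]
    have h3 : associator x n (associator x y z) = 0 := by
      rw [hR.associator_swap_left, hn, neg_zero]
    have h4 := hn x (associator x y z)
    rw [hR.associator_mul_left_self] at h1
    rw [associator_apply, sub_eq_zero] at h2 h3 h4
    rw [← h4, h2, ← hR.commute_associator_of_nuclear hn, ← h3, ← sub_eq_zero, ← sub_mul] at h1
    exact (mul_eq_zero.mp h1).resolve_left h0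
  have key2 := AddMonoidHom.eq_zero_or_eq_zero_of_forall AddMonoidHom.associator
    (AddMonoidHom.mulLeft n - AddMonoidHom.mulRight n)
    (fun x => (key x).imp_left fun h => AddMonoidHom.ext h)
  refine key2.resolve_left (fun h => ?_) x
  obtain ⟨x, y, z, hxyz⟩ := hna
  exact hxyz (by rw [← AddMonoidHom.associator_apply, h x]; rfl)

theorem mem_center_of_nuclear [NoZeroDivisors R] (hR : IsAlternative R)
    (hna : ∃ x y z : R, associator x y z ≠ 0)
    {n : R} (hn : ∀ y z, associator n y z = 0) : n ∈ NonUnitalSubring.center R :=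
  (hR.mem_center_iff n).mpr ⟨hn, hR.commute_of_nuclear hna hn⟩

/-! ### Squares of commutators are central -/

/-- The function vanishes if one argument commutes and associates with another one. -/
theorem kleinfeldFunction_eq_zero (hR : IsAlternative R) {p x : R}
    (hx : ∀ z, associator p x z = 0) (cx : p * x = x * p) (y z : R) :
    kleinfeldFunction p x y z = 0 := by
  rw [hR.kleinfeldFunction_eq, cx, sub_self, hR.associator_cycle _ p x, hx]
  simp only [associator, zero_mul, sub_zero, add_zero]

theorem associator_mul_left_of_commute (hR : IsAlternative R) {p x : R}
    (hx : ∀ z, associator p x z = 0) (cx : p * x = x * p) (w z : R) :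
    associator (w * x) p z = x * associator w p z := by
  have h : kleinfeldFunction w x p z = 0 := by
    rw [hR.kleinfeldFunction_cycle, hR.kleinfeldFunction_swap, hR.kleinfeldFunction_shift_two,
      hR.kleinfeldFunction_eq_zero hx cx, neg_zero, neg_zero]
  rw [kleinfeldFunction, hR.associator_swap_left x, hx, neg_zero, zero_mul, sub_zero] at h
  exact sub_eq_zero.mp h

theorem associator_mul_right_of_commute (hR : IsAlternative R) {p x : R}
    (hx : ∀ z, associator p x z = 0) (cx : p * x = x * p) (w z : R) :
    associator (x * w) p z = associator w p z * x := by
  have h : kleinfeldFunction x w p z = 0 := by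
    rw [hR.kleinfeldFunction_swap_left, hR.kleinfeldFunction_cycle, hR.kleinfeldFunction_swap,
      hR.kleinfeldFunction_shift_two, hR.kleinfeldFunction_eq_zero hx cx]
    simp only [neg_zero]
  rw [kleinfeldFunction, hR.associator_swap_left x, hx, neg_zero, mul_zero, sub_zero] at h
  exact sub_eq_zero.mp h

/-- If `p` commutes and associates with `x` and `y`, and `x`, `y` do not commute, then `p` is
nuclear. The map `δ = (·, p, z)` turns left multiplications by `x`, `y`, `xy` into right
multiplications and conversely, and applying it to `(x, w, y) + (x, y, w) = 0` gives
`δ(w) [x, y] = 0`. -/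
theorem nuclear_of_commute [NoZeroDivisors R] (hR : IsAlternative R) {p x y : R}
    (hx : ∀ z, associator p x z = 0) (cx : p * x = x * p)
    (hy : ∀ z, associator p y z = 0) (cy : p * y = y * p) (hxy : x * y - y * x ≠ 0)
    (w z : R) : associator p w z = 0 := by
  have hxy' : ∀ z, associator p (x * y) z = 0 := by
    intro z
    rw [hR.associator_swap_left, hR.associator_mul_left_of_commute hy cy,
      hR.associator_swap_left x, hx, neg_zero, mul_zero, neg_zero]
  have cxy : p * (x * y) = x * y * p := by
    have h1 := hx y
    have h2 : associator x p y = 0 := by rw [hR.associator_swap_left, hx, neg_zero]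
    have h3 : associator x y p = 0 := by rw [← hR.associator_cycle, hx]
    rw [associator_apply, sub_eq_zero] at h1 h2 h3
    rw [← h1, cx, h2, cy, h3]
  have h1 : associator (associator x w y + associator x y w) p z = 0 := by
    rw [hR.associator_swap_right x w y, neg_add_cancel]
    simp only [associator, zero_mul, sub_zero]
  rw [associator_add_left, associator_apply x w y, associator_apply x y w, associator_sub_left,
    associator_sub_left, hR.associator_mul_left_of_commute hy cy,
    hR.associator_mul_right_of_commute hx cx, hR.associator_mul_right_of_commute hx cx,
    hR.associator_mul_right_of_commute hxy' cxy, hR.associator_mul_left_of_commute hy cy,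
    hR.associator_mul_right_of_commute hx cx, hR.associator_mul_right_of_commute hy cy] at h1
  rw [hR.associator_swap_left p w z, neg_eq_zero]
  generalize associator w p z = d at h1 ⊢
  have h2 := hR.associator_swap_left y d x
  rw [associator_apply, associator_apply] at h2
  refine (mul_eq_zero.mp (?_ : d * (x * y - y * x) = 0)).resolve_right hxy
  rw [mul_sub]
  linear_combination (norm := abel) h1 + h2

theorem commute_sq_commutator_associator (hR : IsAlternative R) (x y z : R) :
    (x * y - y * x) * (x * y - y * x) * associator x y z =
      associator x y z * ((x * y - y * x) * (x * y - y * x)) := by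
  have h := eq_neg_of_add_eq_zero_left (hR.commutator_mul_associator_add x y z)
  generalize x * y - y * x = u at h ⊢
  generalize associator x y z = v at h ⊢
  rw [← hR.left_alternative, h, mul_neg, ← hR.mul_mul_self, h, neg_mul, neg_neg,
    hR.right_alternative]

/-- Besides `v = (x, y, z)`, the product `v x = (x, y, x z)` is an associator too and so commutes
with `p = [x, y]²`; this gives `v (p x) = v (x p)`. -/
theorem commute_sq_commutator_left [NoZeroDivisors R] (hR : IsAlternative R) {x y z : R}
    (h : associator x y z ≠ 0) :
    (x * y - y * x) * (x * y - y * x) * x = x * ((x * y - y * x) * (x * y - y * x)) := by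
  have h1 := hR.commute_sq_commutator_associator x y z
  have h2 := hR.commute_sq_commutator_associator x y (x * z)
  have hp := hR.associator_sq_commutator_left x y (associator x y z)
  rw [hR.associator_self_mul_third] at h2
  generalize (x * y - y * x) * (x * y - y * x) = p at *
  generalize associator x y z = v at *
  have e1 : associator p v x = 0 := by rw [hR.associator_swap_right, hp, neg_zero]
  have e2 : associator v p x = 0 := by rw [hR.associator_swap_left, e1, neg_zero]
  have e3 : associator v x p = 0 := by rw [hR.associator_swap_right, e2, neg_zero]
  rw [associator_apply, sub_eq_zero] at e1 e2 e3
  rw [← e1, h1, e2, e3, ← sub_eq_zero, ← mul_sub] at h2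
  exact sub_eq_zero.mp ((mul_eq_zero.mp h2).resolve_left h)

theorem sq_commutator_nuclear [NoZeroDivisors R] (hR : IsAlternative R) {x y z : R}
    (h : associator x y z ≠ 0) (w t : R) :
    associator ((x * y - y * x) * (x * y - y * x)) w t = 0 := by
  by_cases hu : x * y - y * x = 0
  · rw [hu]; simp only [associator, zero_mul, sub_zero]
  have h' : associator y x z ≠ 0 := by
    rwa [hR.associator_swap_left, neg_ne_zero]
  have cy := hR.commute_sq_commutator_left h'
  rw [← neg_sub (x * y) (y * x), neg_mul_neg] at cy
  exact hR.nuclear_of_commute (hR.associator_sq_commutator_left x y)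
    (hR.commute_sq_commutator_left h) (hR.associator_sq_commutator_right x y) cy hu w t

/-! ### Elements that commute with everything -/

/-- Commutative alternative rings without zero divisors are associative: the three products
`x(yz)`, `y(zx)`, `z(xy)` have common difference `(x, y, z)`, and comparing the differences of
their squares, which are associators of squares, gives `(x, y, z)² = 0`. -/
theorem associator_eq_zero_of_commutative [NoZeroDivisors R] (hR : IsAlternative R)
    (hc : ∀ x y : R, x * y = y * x) (x y z : R) : associator x y z = 0 := by
  have sq : ∀ x w : R, x * w * (x * w) = x * x * (w * w) := by
    intro x w
    rw [hc x w, ← hc x w, hc x w]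
    nth_rw 1 [hc w x]
    rw [hR.middle_moufang, hc, hR.left_alternative]
  have e1 : associator x y z = z * (x * y) - x * (y * z) := by rw [associator_apply, hc _ z]
  have e2 : associator x y z = x * (y * z) - y * (z * x) := by
    rw [hR.associator_cycle, associator_apply, hc _ x]
  have e3 := hR.associator_cycle (x * x) (y * y) (z * z)
  rw [associator_apply, associator_apply, hc _ (z * z), hc _ (x * x), ← sq x y, ← sq y z, ← sq z x,
    ← sq x, ← sq y, ← sq z] at e3
  have e0 : associator x y z = y * (z * x) - z * (x * y) := by
    rw [← hR.associator_cycle, associator_apply, hc _ y]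
  generalize associator x y z = v at *
  have e4 : z * (x * y) = x * (y * z) + v := by rw [e1]; abel
  have e5 : y * (z * x) = x * (y * z) - v := by rw [e2]; abel
  rw [e4, e5] at e3 e0
  generalize x * (y * z) = q at *
  have e6 : v * v + v * v = 0 := by
    simp only [mul_add, add_mul, mul_sub, sub_mul, hc q v] at e3
    linear_combination (norm := abel) e3
  have e7 : v * v + v * v + v * v = 0 := by
    rw [← mul_add, ← mul_add, show v + v + v = 0 by linear_combination (norm := abel) e0, mul_zero]
  rw [e6, zero_add] at e7
  exact mul_self_eq_zero.mp e7

/-- The commutator, as a biadditive map. -/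
def commutatorHom (R : Type*) [NonUnitalNonAssocRing R] : R →+ R →+ R :=
  AddMonoidHom.mul - AddMonoidHom.mul.flip

theorem exists_commutator_ne_zero [NoZeroDivisors R] (hR : IsAlternative R)
    (hna : ∃ x y z : R, associator x y z ≠ 0) : ∃ x y : R, x * y - y * x ≠ 0 := by
  by_contra! h
  obtain ⟨x, y, z, hxyz⟩ := hna
  exact hxyz (hR.associator_eq_zero_of_commutative (fun x y => sub_eq_zero.mp (h x y)) x y z)

/-- Let `a` commute with everything and let `v = (a, y, z)`, `t = (y, z, v)`. Then `v` commutes with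
`y` and `z`, so that `[[y, z], v] = 6 t`. On the other hand `[y, z] v = t = -v [y, z]`, so that
`4 t = 0` and hence `[y, z] v = 0`. -/
theorem commutator_eq_zero_or_associator_eq_zero [NoZeroDivisors R] (hR : IsAlternative R)
    (h2 : ∀ x : R, x + x = 0 → x = 0) {a : R} (ha : ∀ x, a * x = x * a) (y z : R) :
    y * z - z * y = 0 ∨ associator a y z = 0 := by
  rw [hR.associator_cycle]
  have h3 := hR.associator_self_mul_third y z a
  have h4 := hR.associator_second_mul_third y z a
  rw [← ha, hR.associator_mul_self_third] at h3
  rw [← ha, hR.associator_mul_second_third] at h4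
  have h5 := hR.commutator_mul_associator y z a
  have h6 := hR.associator_mul_commutator y z a
  generalize associator y z a = v at *
  have k1 : y * z * v - y * (z * v) = associator y z v := rfl
  have k2 : v * y * z - v * (y * z) = associator y z v := hR.associator_cycle v y z
  have k3 : z * v * y - z * (v * y) = associator y z v := by
    rw [← k2]; exact hR.associator_cycle z v y
  have k4 : y * v * z - y * (v * z) = -associator y z v := hR.associator_swap_right y v z
  have k5 : z * y * v - z * (y * v) = -associator y z v := hR.associator_swap_left z y v
  have k6 : v * z * y - v * (z * y) = -associator y z v := by
    rw [← k2]; exact hR.associator_swap_right v z y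
  generalize associator y z v = t at *
  rw [sub_mul] at h5
  rw [mul_sub] at h6
  rw [h3] at k4 k5
  rw [h4] at k1 k3
  have h7 : t + t + (t + t) = 0 := by
    linear_combination (norm := abel) h5 - h6 - (k1 + k2 + k3 - k4 - k5 - k6)
  rw [h2 _ (h2 _ h7), ← sub_mul] at h5
  exact mul_eq_zero.mp h5

theorem associator_eq_zero_of_commute [NoZeroDivisors R] (hR : IsAlternative R)
    (hna : ∃ x y z : R, associator x y z ≠ 0)
    (h2 : ∀ x : R, x + x = 0 → x = 0) {a : R} (ha : ∀ x, a * x = x * a) (y z : R) :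
    associator a y z = 0 := by
  have h := AddMonoidHom.eq_zero_or_eq_zero_of_forall (commutatorHom R)
    (AddMonoidHom.associator a) fun y => by
      refine (AddMonoidHom.eq_zero_or_eq_zero_of_forall (commutatorHom R y)
        (AddMonoidHom.associator a y) fun z => ?_).imp
        (fun h => AddMonoidHom.ext h) (fun h => AddMonoidHom.ext h)
      exact hR.commutator_eq_zero_or_associator_eq_zero h2 ha y z
  rcases h with h | h
  · obtain ⟨x, y, hxy⟩ := hR.exists_commutator_ne_zero hna
    exact absurd (DFunLike.congr_fun (h x) y) hxy
  · exact DFunLike.congr_fun (h y) z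

/-- Every non-central `a` has a partner `b` that neither commutes nor associates with it. -/
theorem exists_commutator_associator_ne_zero [NoZeroDivisors R] (hR : IsAlternative R)
    (hna : ∃ x y z : R, associator x y z ≠ 0)
    (h2 : ∀ x : R, x + x = 0 → x = 0) {a : R} (ha : a ∉ NonUnitalSubring.center R) :
    ∃ b z : R, a * b - b * a ≠ 0 ∧ associator a b z ≠ 0 := by
  by_contra! hne
  rcases AddMonoidHom.eq_zero_or_eq_zero_of_forall (commutatorHom R a)
    (AddMonoidHom.associator a) (fun b => or_iff_not_imp_left.mpr fun h =>
      AddMonoidHom.ext fun z => hne b z h) with h | h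
  · exact ha (hR.mem_center_of_nuclear hna
      (hR.associator_eq_zero_of_commute hna h2 fun x => sub_eq_zero.mp (h x)))
  · exact ha (hR.mem_center_of_nuclear hna fun y z => DFunLike.congr_fun (h y) z)

theorem exists_center_ne_zero [NoZeroDivisors R] (hR : IsAlternative R)
    (hna : ∃ x y z : R, associator x y z ≠ 0) (h2 : ∀ x : R, x + x = 0 → x = 0) :
    ∃ c ∈ NonUnitalSubring.center R, c ≠ 0 := by
  obtain ⟨a, y, z, ha⟩ := hna
  have ha' : a ∉ NonUnitalSubring.center R := fun h =>
    ha (((hR.mem_center_iff a).mp h).1 y z)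
  obtain ⟨b, z, hb, hz⟩ := hR.exists_commutator_associator_ne_zero ⟨a, y, _, ha⟩ h2 ha'
  exact ⟨_, hR.mem_center_of_nuclear ⟨a, y, _, ha⟩ (hR.sq_commutator_nuclear hz),
    mul_self_ne_zero.mpr hb⟩

end IsAlternative

namespace IsAlternative

/-! ### The quadratic equation -/

/-- If every central element is a scalar, every element satisfies a quadratic equation. For a
non-central `a` take a commutator `u = [a, b]`; then `u`, `a u = [a, a b]` and `u + a u` have
scalar squares, so that `u a + a u = t u` for a scalar `t`, and hence `(a u)² = (t a - a²) u²`. -/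
theorem exists_quadratic_equation {F A : Type*} [Field F] [NonAssocRing A] [Module F A]
    [IsScalarTower F A A] [SMulCommClass F A A] [NoZeroDivisors A] (hA : IsAlternative A)
    (hna : ∃ x y z : A, associator x y z ≠ 0) (h2 : ∀ x : A, x + x = 0 → x = 0)
    (hF : ∀ c ∈ NonUnitalSubring.center A, ∃ r : F, c = r • (1 : A)) (a : A) :
    ∃ t n : F, a * a = t • a + n • (1 : A) := by
  by_cases ha : a ∈ NonUnitalSubring.center A
  · obtain ⟨r, hr⟩ := hF a ha
    refine ⟨r, 0, ?_⟩
    nth_rw 1 [hr]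
    rw [smul_one_mul, zero_smul, add_zero]
  obtain ⟨b, z, hu, hv⟩ := hA.exists_commutator_associator_ne_zero hna h2 ha
  have hF' : ∀ b', associator a b' z ≠ 0 →
      ∃ r : F, (a * b' - b' * a) * (a * b' - b' * a) = r • (1 : A) := fun b' h =>
    hF _ (hA.mem_center_of_nuclear hna (hA.sq_commutator_nuclear h))
  have ha0 : a ≠ 0 := by
    rintro rfl
    exact ha (zero_mem _)
  have ha1 : 1 + a ≠ 0 := by
    intro h
    rw [← neg_eq_iff_add_eq_zero] at h
    rw [← h] at ha
    exact ha (neg_mem (Set.one_mem_center))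
  -- The commutator of `a` and `a b` is `a u`.
  have hc : a * (a * b) - a * b * a = a * (a * b - b * a) := by rw [mul_sub, hA.mul_mul_self]
  have hvb : associator a (a * b) z ≠ 0 := by
    rw [hA.associator_mul_right_self]
    exact mul_ne_zero hv ha0
  obtain ⟨α, hα⟩ := hF' b hv
  obtain ⟨β, hβ⟩ := hF' (a * b) hvb
  obtain ⟨γ, hγ⟩ := hF' (b + a * b) (by
    rw [associator_add_middle, hA.associator_mul_right_self]
    nth_rw 1 [← mul_one (associator a b z)]
    rw [← mul_add]
    exact mul_ne_zero hv ha1)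
  rw [mul_add, add_mul, add_sub_add_comm] at hγ
  rw [hc] at hβ hγ
  generalize a * b - b * a = u at *
  have hα0 : α ≠ 0 := by
    rintro rfl
    rw [zero_smul] at hα
    exact hu (mul_self_eq_zero.mp hα)
  have h1 : (u * a + a * u) * u = (γ - α - β) • (1 : A) := by
    rw [add_mul, hA.mul_mul_self, sub_smul, sub_smul, ← hα, ← hβ, ← hγ]
    simp only [mul_add, add_mul]
    abel
  have h3 : u * a + a * u = ((γ - α - β) / α) • u := by
    have h := hA.right_alternative (u * a + a * u) u
    rw [h1, hα, smul_one_mul, mul_smul_comm, mul_one] at h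
    rw [div_eq_inv_mul, mul_smul, h, inv_smul_smul₀ hα0]
  generalize (γ - α - β) / α = t at h3
  refine ⟨t, -(β / α), ?_⟩
  have h4 : a * u * (a * u) = α • (t • a - a * a) := by
    nth_rw 2 [show a * u = t • u - u * a by rw [← h3]; abel]
    rw [mul_sub, mul_smul_comm, hA.right_alternative, hA.middle_moufang, hα, mul_smul_comm,
      mul_one, smul_mul_assoc, smul_sub, smul_comm]
  rw [hβ] at h4
  have h5 : t • a - a * a = (β / α) • (1 : A) := by
    rw [div_eq_inv_mul, mul_smul, h4, inv_smul_smul₀ hα0]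
  rw [neg_smul, ← h5]
  abel

/-! ### Anticommuting elements -/

section Anticommuting

variable {R : Type*} [NonUnitalNonAssocRing R]

/-- Two elements anticommute. -/
def Anticommute (x y : R) : Prop := x * y + y * x = 0

theorem Anticommute.symm {x y : R} (h : Anticommute x y) : Anticommute y x := by
  rwa [Anticommute, add_comm]

theorem Anticommute.eq_neg {x y : R} (h : Anticommute x y) : x * y = -(y * x) :=
  eq_neg_of_add_eq_zero_left h

theorem Anticommute.neg_left {x y : R} (h : Anticommute x y) : Anticommute (-x) y := by
  rw [Anticommute, neg_mul, mul_neg, ← neg_add, h, neg_zero]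

theorem anticommute_self_mul (hR : IsAlternative R) {x y : R} (h : Anticommute x y) :
    Anticommute x (x * y) := by
  rw [Anticommute, hR.mul_mul_self, ← mul_add, h, mul_zero]

theorem anticommute_right_mul (hR : IsAlternative R) {x y : R} (h : Anticommute x y) :
    Anticommute y (x * y) := by
  rw [Anticommute, ← hR.mul_mul_self, ← add_mul, h.symm, zero_mul]

theorem mul_mul_cycle (hR : IsAlternative R) {x y z : R} (hxy : Anticommute x y)
    (hzx : Anticommute z x) : x * y * z = y * z * x := by
  have h := hR.associator_swap_right y x z
  rw [associator_apply, associator_apply, hzx.symm.eq_neg, mul_neg] at h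
  rw [hxy.eq_neg, neg_mul]
  linear_combination (norm := abel) -h

theorem mul_mul_cycle_left (hR : IsAlternative R) {x y z : R}
    (hyz : Anticommute y z) (hzx : Anticommute z x) : z * (x * y) = x * (y * z) := by
  have h1 := hR.associator_swap_left x z y
  rw [associator_apply, associator_apply, hzx.eq_neg, neg_mul] at h1
  rw [hyz.eq_neg, mul_neg]
  linear_combination (norm := abel) -h1

theorem anticommute_cycle (hR : IsAlternative R) {x y z : R} (hxy : Anticommute x y)
    (hyz : Anticommute y z) (hzx : Anticommute z x) (h : Anticommute (x * y) z) :
    Anticommute (y * z) x := by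
  rw [Anticommute, ← hR.mul_mul_cycle hxy hzx, ← hR.mul_mul_cycle_left hyz hzx]
  exact h

theorem mul_mul_eq_neg (hR : IsAlternative R) {x y z : R}
    (hyz : Anticommute y z) (hzx : Anticommute z x) (h : Anticommute (x * y) z) :
    x * (y * z) = -(x * y * z) := by
  rw [← hR.mul_mul_cycle_left hyz hzx, h.symm.eq_neg]

/-- Both products are of the form `y (·) y` by the middle Moufang identity. -/
theorem anticommute_mul_mul (hR : IsAlternative R) {x y z : R} (hxy : Anticommute x y)
    (hyz : Anticommute y z) (hzx : Anticommute z x) : Anticommute (x * y) (y * z) := by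
  rw [Anticommute, hxy.eq_neg, hyz.eq_neg, neg_mul_neg, hR.middle_moufang, neg_mul_neg]
  rw [← neg_mul_neg (z * y), ← hyz.eq_neg, ← hxy.eq_neg, hR.middle_moufang, ← add_mul, ← mul_add,
    hzx.symm, mul_zero, zero_mul]

/-- No non-zero element is orthogonal to the octonion subalgebra generated by three suitable
anticommuting elements: computing `x (y (z w))` in
two ways gives `((x y) z) w` with both signs. -/
theorem eq_zero_of_anticommute [NoZeroDivisors R] (hR : IsAlternative R)
    (h2 : ∀ x : R, x + x = 0 → x = 0) {x y z w : R}
    (hxy : Anticommute x y) (hyz : Anticommute y z) (hzx : Anticommute z x)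
    (hxyz : Anticommute (x * y) z) (hx : Anticommute x w) (hy : Anticommute y w)
    (hz : Anticommute z w) (hwxy : Anticommute (x * y) w) (hwyz : Anticommute (y * z) w)
    (hwzx : Anticommute (z * x) w) (hw : Anticommute (x * y * z) w) :
    x * y * z * w = 0 := by
  have hx_yz : Anticommute x (y * z) := (hR.anticommute_cycle hxy hyz hzx hxyz).symm
  have e0 := hR.mul_mul_eq_neg hyz hzx hxyz
  have e1 := hR.mul_mul_eq_neg hz hy.symm hwyz
  have e2 := hR.mul_mul_eq_neg hwyz hx.symm (by rw [e0]; exact hw.neg_left)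
  have hzw_y := hR.anticommute_cycle hyz hz hy.symm hwyz
  have hzw_x := hR.anticommute_cycle hzx.symm hz hx.symm
    (by rw [hzx.symm.eq_neg]; exact hwzx.neg_left)
  have hzw_xy := hR.anticommute_cycle hxyz hz hwxy.symm hw
  have e3 := hR.mul_mul_eq_neg hzw_y.symm hzw_x hzw_xy.symm
  have e4 := hR.mul_mul_eq_neg hz hwxy.symm hw
  rw [e1, mul_neg, e2, e0, e4, neg_neg, neg_neg, neg_mul] at e3
  exact h2 _ (neg_eq_iff_add_eq_zero.mp e3)

end Anticommuting

end IsAlternative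

namespace IsAlternative

/-! ### Vectors and scalars in quadratic algebras -/

section Quadratic

variable {F A : Type*} [Field F] [NonAssocRing A] [Module F A]

/-- A vector of a quadratic algebra: an element with a scalar square which is not itself a
non-zero scalar. -/
def IsPure (F : Type*) {A : Type*} [Field F] [NonAssocRing A] [Module F A] (x : A) : Prop :=
  (∃ c : F, x * x = c • (1 : A)) ∧ ∀ r : F, x = r • (1 : A) → x = 0

theorem IsPure.zero : IsPure F (0 : A) :=
  ⟨⟨0, by rw [mul_zero, zero_smul]⟩, fun _ _ => rfl⟩

variable [IsScalarTower F A A] [SMulCommClass F A A]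

theorem IsPure.smul {x : A} (hx : IsPure F x) (s : F) : IsPure F (s • x) := by
  obtain ⟨⟨c, hc⟩, h⟩ := hx
  refine ⟨⟨s * (s * c), ?_⟩, fun r hr => ?_⟩
  · rw [smul_mul_smul_comm, hc, smul_smul, mul_assoc]
  · by_cases hs : s = 0
    · rw [hs, zero_smul]
    · rw [h (s⁻¹ * r) (by rw [mul_smul, ← hr, inv_smul_smul₀ hs]), smul_zero]

/-- If `x` and `y` are independent modulo scalars, the quadratic equations of `x + y` and `x - y`
add up to one that forces both linear coefficients to vanish. -/
theorem IsPure.add (h2 : (2 : F) ≠ 0) (hq : ∀ a : A, ∃ t n : F, a * a = t • a + n • (1 : A))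
    {x y : A} (hx : IsPure F x) (hy : IsPure F y) : IsPure F (x + y) := by
  by_cases hy0 : y = 0
  · rwa [hy0, add_zero]
  by_cases hd : ∃ α β : F, x = α • y + β • (1 : A)
  · obtain ⟨α, β, hxe⟩ := hd
    obtain ⟨c, hc⟩ := hx.1
    obtain ⟨d, hd⟩ := hy.1
    have h : (2 * (α * β)) • y = (c - α * α * d - β * β) • (1 : A) := by
      rw [sub_smul, sub_smul, ← hc, mul_smul (α * α), ← hd, hxe]
      simp only [mul_add, add_mul, smul_mul_assoc, mul_smul_comm, mul_one, one_mul]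
      module
    have hαβ : α * β = 0 := by
      by_contra hne
      have hne2 : 2 * (α * β) ≠ 0 := mul_ne_zero h2 hne
      exact hy0 (hy.2 ((2 * (α * β))⁻¹ * (c - α * α * d - β * β))
        (by rw [mul_smul, ← h, inv_smul_smul₀ hne2]))
    rcases mul_eq_zero.mp hαβ with h0 | h0
    · rw [h0, zero_smul, zero_add] at hxe
      rwa [hx.2 β hxe, zero_add]
    · rw [h0, zero_smul, add_zero] at hxe
      rw [hxe, show α • y + y = (α + 1) • y by module]
      exact hy.smul _
  · obtain ⟨c, hc⟩ := hx.1
    obtain ⟨d, hd'⟩ := hy.1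
    obtain ⟨t, n, h1⟩ := hq (x + y)
    obtain ⟨s, m, h3⟩ := hq (x - y)
    have h4 : (t + s) • x = (s - t) • y + (2 * (c + d) - n - m) • (1 : A) := by
      have : (2 * (c + d)) • (1 : A) = (x + y) * (x + y) + (x - y) * (x - y) := by
        rw [mul_smul, add_smul, ← hc, ← hd', two_smul]
        simp only [mul_add, add_mul, mul_sub, sub_mul]
        abel
      rw [sub_smul _ m, sub_smul _ n, this, h1, h3]
      module
    have h5 : t + s = 0 := by
      by_contra hne
      refine hd ⟨(t + s)⁻¹ * (s - t), (t + s)⁻¹ * (2 * (c + d) - n - m), ?_⟩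
      rw [mul_smul, mul_smul, ← smul_add, ← h4, inv_smul_smul₀ hne]
    have h6 : s - t = 0 := by
      by_contra hne
      refine hy0 (hy.2 ((s - t)⁻¹ * -(2 * (c + d) - n - m)) ?_)
      rw [h5, zero_smul] at h4
      rw [mul_smul, neg_smul, ← eq_neg_of_add_eq_zero_left h4.symm, inv_smul_smul₀ hne]
    have ht : t = 0 := by
      have : 2 * t = 0 := by linear_combination h5 - h6
      exact (mul_eq_zero.mp this).resolve_left h2
    refine ⟨⟨n, by rw [h1, ht, zero_smul, zero_add]⟩, fun r hr => ?_⟩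
    exact absurd ⟨-1, r, by rw [← hr]; module⟩ hd

theorem exists_isPure_sub (h2 : (2 : F) ≠ 0)
    (hq : ∀ a : A, ∃ t n : F, a * a = t • a + n • (1 : A)) (a : A) :
    ∃ r : F, IsPure F (a - r • (1 : A)) := by
  by_cases ha : ∃ r : F, a = r • (1 : A)
  · obtain ⟨r, rfl⟩ := ha
    exact ⟨r, by rw [sub_self]; exact IsPure.zero⟩
  obtain ⟨t, n, h⟩ := hq a
  refine ⟨t / 2, ⟨n + t / 2 * (t / 2), ?_⟩, fun s hs => ?_⟩
  · have ht : t = t / 2 + t / 2 := by field_simp; ring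
    rw [mul_sub, sub_mul, sub_mul, h]
    simp only [mul_smul_comm, smul_mul_assoc, mul_one, one_mul]
    nth_rw 1 [ht]
    module
  · exact absurd ⟨s + t / 2, by rw [add_smul, ← hs]; abel⟩ ha

/-- A projection of a quadratic algebra onto its scalars along the vectors: half the trace. -/
structure IsScalarPart (l : A →ₗ[F] F) : Prop where
  map_one : l 1 = 1
  isPure_iff : ∀ x, IsPure F x ↔ l x = 0

theorem exists_isScalarPart [Nontrivial A] (h2 : (2 : F) ≠ 0)
    (hq : ∀ a : A, ∃ t n : F, a * a = t • a + n • (1 : A)) :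
    ∃ l : A →ₗ[F] F, IsScalarPart l := by
  have huniq : ∀ r : F, IsPure F (r • (1 : A)) → r = 0 := fun r hr =>
    (smul_eq_zero.mp (hr.2 r rfl)).resolve_right one_ne_zero
  choose l hl using fun a : A => exists_isPure_sub h2 hq a
  have hl' : ∀ a r, IsPure F (a - r • (1 : A)) → l a = r := by
    intro a r h
    refine sub_eq_zero.mp (huniq _ ?_)
    convert h.add h2 hq ((hl a).smul (-1)) using 1
    module
  refine ⟨{ toFun := l, map_add' := fun a b => hl' _ _ ?_, map_smul' := fun c a => hl' _ _ ?_ },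
    hl' _ _ ?_, fun x => ⟨fun hx => hl' _ _ ?_, fun hx => ?_⟩⟩
  · convert (hl a).add h2 hq (hl b) using 1
    module
  · convert (hl a).smul c using 1
    simp only [smul_eq_mul, RingHom.id_apply]
    module
  · rw [one_smul, sub_self]
    exact IsPure.zero
  · rwa [zero_smul, sub_zero]
  · have h := hl x
    rwa [show l x = 0 from hx, zero_smul, sub_zero] at h

end Quadratic

end IsAlternative

namespace IsAlternative

section ScalarPart

variable {F A : Type*} [Field F] [NonAssocRing A] [Module F A] {l : A →ₗ[F] F}

theorem IsScalarPart.mul_self (hl : IsScalarPart l) {x : A} (hx : l x = 0) :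
    x * x = l (x * x) • (1 : A) := by
  obtain ⟨c, hc⟩ := ((hl.isPure_iff x).mpr hx).1
  rw [hc, map_smul, hl.map_one, smul_eq_mul, mul_one]

theorem IsScalarPart.map_sub_self (hl : IsScalarPart l) (a : A) : l (a - l a • (1 : A)) = 0 := by
  rw [map_sub, map_smul, hl.map_one, smul_eq_mul, mul_one, sub_self]

/-- The conjugation `a ↦ t(a) - a`, where the trace `t` is twice the scalar part. -/
def conj (l : A →ₗ[F] F) : A →ₗ[F] A := (2 : F) • l.smulRight (1 : A) - LinearMap.id

theorem conj_apply (l : A →ₗ[F] F) (a : A) : conj l a = (2 * l a) • (1 : A) - a := by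
  simp [conj, mul_smul]

theorem IsScalarPart.mul_add_mul (hl : IsScalarPart l) {x y : A} (hx : l x = 0) (hy : l y = 0) :
    x * y + y * x = l (x * y + y * x) • (1 : A) := by
  have h : x * y + y * x = (x + y) * (x + y) - x * x - y * y := by
    simp only [add_mul, mul_add]; abel
  rw [h, map_sub, map_sub, sub_smul, sub_smul, ← hl.mul_self hx, ← hl.mul_self hy,
    ← hl.mul_self (by rw [map_add, hx, hy, add_zero])]

variable [IsScalarTower F A A] [SMulCommClass F A A]

/-- The trace is symmetric. If `xy` is not a scalar, the trace can be read off from the quadratic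
equation of `xy`; if `xy` is a scalar, then `yx = xy`. -/
theorem IsScalarPart.map_mul_comm_of_pure [NoZeroDivisors A] (hl : IsScalarPart l)
    (hA : IsAlternative A) (h2 : (2 : F) ≠ 0) {x y : A} (hx : l x = 0) (hy : l y = 0) :
    l (x * y) = l (y * x) := by
  by_cases hμ : ∃ μ : F, x * y = μ • (1 : A)
  · obtain ⟨μ, hμ⟩ := hμ
    by_cases hx0 : x = 0
    · rw [hx0, zero_mul, mul_zero]
    have h : x * (y * x - μ • (1 : A)) = 0 := by
      rw [mul_sub, ← hA.mul_mul_self, hμ, mul_smul_comm, smul_mul_assoc, one_mul, mul_one, sub_self]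
    rw [sub_eq_zero.mp ((mul_eq_zero.mp h).resolve_left hx0), hμ]
  · have h1 := hl.mul_add_mul hx hy
    have h3 := map_add l (x * y) (y * x)
    generalize l (x * y + y * x) = s at h1 h3
    -- The quadratic equation `(xy)² = s (xy) - x² y²` identifies the trace of `xy`.
    have h4 : x * y * (x * y) = s • (x * y) - (l (x * x) * l (y * y)) • (1 : A) := by
      have h := hA.middle_moufang x y y
      rw [hl.mul_self hy, mul_smul_comm, mul_one, smul_mul_assoc, hl.mul_self hx, smul_smul] at h
      nth_rw 2 [eq_sub_of_add_eq h1]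
      rw [mul_sub, mul_smul_comm, mul_one, h, mul_comm (l (y * y))]
    have hs : s / 2 + s / 2 = s := by field_simp; ring
    have h5 : IsPure F (x * y - (s / 2) • (1 : A)) := by
      refine ⟨⟨s / 2 * (s / 2) - l (x * x) * l (y * y), ?_⟩, fun r hr => ?_⟩
      · rw [mul_sub, sub_mul, sub_mul, h4]
        simp only [mul_smul_comm, smul_mul_assoc, mul_one, one_mul]
        nth_rw 1 [← hs]
        module
      · exact absurd ⟨r + s / 2, by rw [add_smul, ← hr]; abel⟩ hμ
    rw [hl.isPure_iff, map_sub, map_smul, hl.map_one, smul_eq_mul, mul_one] at h5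
    linear_combination 2 * h5 + h3 + hs

theorem IsScalarPart.map_mul_comm [NoZeroDivisors A] (hl : IsScalarPart l)
    (hA : IsAlternative A) (h2 : (2 : F) ≠ 0) (a b : A) : l (a * b) = l (b * a) := by
  have h := hl.map_mul_comm_of_pure hA h2 (hl.map_sub_self a) (hl.map_sub_self b)
  simp only [mul_sub, sub_mul, map_sub, mul_smul_comm, smul_mul_assoc, mul_one, one_mul, map_smul,
    hl.map_one, smul_eq_mul] at h
  linear_combination h

theorem IsScalarPart.mul_add_mul_of_pure [NoZeroDivisors A] (hl : IsScalarPart l)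
    (hA : IsAlternative A) (h2 : (2 : F) ≠ 0) {x y : A} (hx : l x = 0) (hy : l y = 0) :
    x * y + y * x = (2 * l (x * y)) • (1 : A) := by
  rw [hl.mul_add_mul hx hy, map_add, ← hl.map_mul_comm hA h2 x y, two_mul]

/-- For vectors, anticommuting is the same as orthogonality. -/
theorem IsScalarPart.anticommute_iff [NoZeroDivisors A] [Nontrivial A] (hl : IsScalarPart l)
    (hA : IsAlternative A) (h2 : (2 : F) ≠ 0) {x y : A} (hx : l x = 0) (hy : l y = 0) :
    Anticommute x y ↔ l (x * y) = 0 := by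
  rw [Anticommute, hl.mul_add_mul_of_pure hA h2 hx hy, smul_eq_zero]
  simp [h2]

/-! ### The norm form -/

/-- The norm form: `n(a)` is the scalar part of `a ā`. -/
noncomputable def normForm (l : A →ₗ[F] F) : QuadraticForm F A :=
  LinearMap.BilinMap.toQuadraticMap (((LinearMap.mul F A).compr₂ l).compl₂ (conj l))

theorem normForm_apply (l : A →ₗ[F] F) (a : A) : normForm l a = l (a * conj l a) := rfl

theorem IsScalarPart.mul_conj (hl : IsScalarPart l) (a : A) :
    a * conj l a = normForm l a • (1 : A) := by
  have h := hl.mul_self (hl.map_sub_self a)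
  have e : (a - l a • (1 : A)) * (a - l a • (1 : A))
      = (l a * l a) • (1 : A) - a * conj l a := by
    rw [conj_apply]
    simp only [mul_sub, sub_mul, mul_smul_comm, smul_mul_assoc, mul_one, one_mul]
    module
  rw [e, map_sub, map_smul, hl.map_one, sub_smul, smul_eq_mul, mul_one, ← normForm_apply] at h
  exact sub_right_injective h

theorem IsScalarPart.conj_mul [NoZeroDivisors A] (hl : IsScalarPart l)
    (hA : IsAlternative A) (h2 : (2 : F) ≠ 0) (a b : A) :
    conj l (a * b) = conj l b * conj l a := by
  have h := hl.mul_add_mul_of_pure hA h2 (hl.map_sub_self a) (hl.map_sub_self b)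
  simp only [conj_apply]
  simp only [mul_sub, sub_mul, map_sub, mul_smul_comm, smul_mul_assoc, mul_one, one_mul, map_smul,
    hl.map_one, smul_eq_mul] at h ⊢
  linear_combination (norm := module) -h

theorem IsScalarPart.normForm_mul [NoZeroDivisors A] [Nontrivial A] (hl : IsScalarPart l)
    (hA : IsAlternative A) (h2 : (2 : F) ≠ 0) (a b : A) :
    normForm l (a * b) = normForm l a * normForm l b := by
  have h1 : a * b * conj l b = normForm l b • a := by
    have h := hA.right_alternative a b
    have h' := congrArg (a * ·) (hl.mul_conj b)
    simp only [conj_apply, mul_sub, mul_smul_comm, mul_one] at h' ⊢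
    rw [h, h']
  have h3 : a * b * (conj l b * a) = normForm l b • (a * a) := by
    rw [hA.middle_moufang, hl.mul_conj, mul_smul_comm, mul_one, smul_mul_assoc]
  have h4 : a * b * (conj l b * conj l a) = (normForm l a * normForm l b) • (1 : A) := by
    rw [conj_apply l a, mul_sub, mul_sub, mul_smul_comm, mul_one, h3, mul_smul_comm, h1,
      mul_comm (normForm l a), mul_smul _ (normForm l a), ← hl.mul_conj a, conj_apply, mul_sub,
      mul_smul_comm, mul_one, smul_sub, smul_comm]
  rw [← hl.conj_mul hA h2, hl.mul_conj] at h4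
  exact smul_left_injective F (one_ne_zero (α := A)) h4

theorem IsScalarPart.normForm_ne_zero [NoZeroDivisors A] (hl : IsScalarPart l)
    {a : A} (ha : a ≠ 0) : normForm l a ≠ 0 := by
  intro h
  have h1 := hl.mul_conj a
  rw [h, zero_smul] at h1
  have h3 := (mul_eq_zero.mp h1).resolve_left ha
  rw [conj_apply] at h3
  have h4 := congrArg l h3
  rw [map_sub, map_smul, hl.map_one, smul_eq_mul, mul_one, map_zero] at h4
  have h5 : l a = 0 := by linear_combination h4
  rw [h5, mul_zero, zero_smul, zero_sub, neg_eq_zero] at h3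
  exact ha h3

theorem IsScalarPart.isCompositionAlgebra [NoZeroDivisors A] [Nontrivial A] (hl : IsScalarPart l)
    (hA : IsAlternative A) (h2 : (2 : F) ≠ 0) : IsCompositionAlgebra F A := by
  have hpolar : ∀ a, QuadraticMap.polarBilin (normForm l) a a = 0 → a = 0 := by
    intro a ha
    by_contra h0
    rw [QuadraticMap.polarBilin_apply_apply, QuadraticMap.polar_self, two_nsmul, ← two_mul] at ha
    exact (mul_ne_zero h2 (hl.normForm_ne_zero h0)) ha
  exact ⟨normForm l, hl.normForm_mul hA h2, fun a h => hpolar a (h a), fun a h => hpolar a (h a)⟩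

theorem IsScalarPart.mul_conj_mul (hl : IsScalarPart l) (hA : IsAlternative A) (a b : A) :
    a * (conj l a * b) = normForm l a • b := by
  have h := hl.mul_conj a
  have h' := congrArg (· * b) h
  simp only [conj_apply, mul_sub, sub_mul, mul_smul_comm, smul_mul_assoc, mul_one, one_mul] at h' ⊢
  rw [hA.left_alternative, h']

theorem IsScalarPart.mul_conj_mul_right (hl : IsScalarPart l) (hA : IsAlternative A) (a b : A) :
    b * conj l a * a = normForm l a • b := by
  have h := hl.mul_conj a
  have h' := congrArg (b * ·) h
  simp only [conj_apply, mul_sub, sub_mul, mul_smul_comm, smul_mul_assoc, mul_one] at h' ⊢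
  rw [hA.right_alternative, h']

theorem IsScalarPart.existsUnique_mul_left [NoZeroDivisors A] [Nontrivial A]
    (hl : IsScalarPart l) (hA : IsAlternative A) (a b : A) (ha : a ≠ 0) :
    ∃! x : A, a * x = b := by
  refine ⟨(normForm l a)⁻¹ • (conj l a * b), ?_, fun y hy => ?_⟩
  · simp only
    rw [mul_smul_comm, hl.mul_conj_mul hA, inv_smul_smul₀ (hl.normForm_ne_zero ha)]
  · refine sub_eq_zero.mp ((mul_eq_zero.mp ?_).resolve_left ha)
    rw [mul_sub, hy, mul_smul_comm, hl.mul_conj_mul hA,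
      inv_smul_smul₀ (hl.normForm_ne_zero ha), sub_self]

theorem IsScalarPart.existsUnique_mul_right [NoZeroDivisors A] [Nontrivial A]
    (hl : IsScalarPart l) (hA : IsAlternative A) (a b : A) (ha : a ≠ 0) :
    ∃! y : A, y * a = b := by
  refine ⟨(normForm l a)⁻¹ • (b * conj l a), ?_, fun y hy => ?_⟩
  · simp only
    rw [smul_mul_assoc, hl.mul_conj_mul_right hA, inv_smul_smul₀ (hl.normForm_ne_zero ha)]
  · refine sub_eq_zero.mp ((mul_eq_zero.mp ?_).resolve_right ha)
    rw [sub_mul, hy, smul_mul_assoc, hl.mul_conj_mul_right hA,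
      inv_smul_smul₀ (hl.normForm_ne_zero ha), sub_self]

end ScalarPart

end IsAlternative

namespace IsAlternative

/-! ### The dimension -/

section Dimension

variable {F A : Type*} [Field F] [NonAssocRing A] [Module F A] {l : A →ₗ[F] F}

theorem associator_one_left (y z : A) : associator 1 y z = 0 := by
  rw [associator_apply, one_mul, one_mul, sub_self]

theorem associator_one_middle (x z : A) : associator x 1 z = 0 := by
  rw [associator_apply, mul_one, one_mul, sub_self]

theorem associator_one_right (x y : A) : associator x y 1 = 0 := by
  rw [associator_apply, mul_one, mul_one, sub_self]

theorem associator_smul_left [IsScalarTower F A A] (r : F) (x y z : A) :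
    associator (r • x) y z = r • associator x y z := by
  simp only [associator_apply, smul_mul_assoc, smul_sub]

theorem associator_smul_middle [IsScalarTower F A A] [SMulCommClass F A A] (r : F) (x y z : A) :
    associator x (r • y) z = r • associator x y z := by
  simp only [associator_apply, smul_mul_assoc, mul_smul_comm, smul_sub]

theorem associator_smul_right [SMulCommClass F A A] (r : F) (x y z : A) :
    associator x y (r • z) = r • associator x y z := by
  simp only [associator_apply, mul_smul_comm, smul_sub]

variable [NoZeroDivisors A]

theorem IsScalarPart.map_mul_self_ne_zero (hl : IsScalarPart l) {x : A} (hx : l x = 0)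
    (h0 : x ≠ 0) : l (x * x) ≠ 0 := by
  intro h
  have h1 := hl.mul_self hx
  rw [h, zero_smul] at h1
  exact h0 (mul_self_eq_zero.mp h1)

variable [IsScalarTower F A A] [SMulCommClass F A A] [Nontrivial A]

/-- Orthogonalizing the entries of a non-zero associator `(x, y, z)`, in such a way that the
associator does not change. -/
theorem IsScalarPart.exists_orthogonal_triple (hl : IsScalarPart l) (hA : IsAlternative A)
    (h2 : (2 : F) ≠ 0) (hna : ∃ x y z : A, associator x y z ≠ 0) :
    ∃ x y z : A, (x ≠ 0 ∧ y ≠ 0 ∧ z ≠ 0) ∧ (l x = 0 ∧ l y = 0 ∧ l z = 0) ∧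
      l (x * y) = 0 ∧ l (x * z) = 0 ∧ l (y * z) = 0 ∧ l (x * y * z) = 0 := by
  obtain ⟨a, b, c, h⟩ := hna
  have hne : ∀ {x y z : A}, associator x y z ≠ 0 → x ≠ 0 ∧ y ≠ 0 ∧ z ≠ 0 := by
    intro x y z h
    refine ⟨?_, ?_, ?_⟩ <;> rintro rfl <;>
      simp [associator_apply] at h
  obtain ⟨x, hx, h⟩ : ∃ x, l x = 0 ∧ associator x b c ≠ 0 := by
    refine ⟨a - l a • (1 : A), hl.map_sub_self a, ?_⟩
    rwa [associator_sub_left, associator_smul_left, associator_one_left, smul_zero, sub_zero]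
  have hx0 := (hne h).1
  have hxx := hl.map_mul_self_ne_zero hx hx0
  obtain ⟨y, hy, hxy, h⟩ : ∃ y, l y = 0 ∧ l (x * y) = 0 ∧ associator x y c ≠ 0 := by
    refine ⟨b - l b • (1 : A) - (l (x * (b - l b • (1 : A))) / l (x * x)) • x, ?_, ?_, ?_⟩
    · rw [map_sub, hl.map_sub_self, map_smul, hx, smul_zero, sub_zero]
    · rw [mul_sub, map_sub, mul_smul_comm, map_smul, smul_eq_mul, div_mul_cancel₀ _ hxx, sub_self]
    · rwa [associator_sub_middle, associator_sub_middle, associator_smul_middle,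
        associator_smul_middle, associator_one_middle, (hA _ x).2, smul_zero, smul_zero, sub_zero,
        sub_zero]
  have hy0 := (hne h).2.1
  have hyy := hl.map_mul_self_ne_zero hy hy0
  have hpp := hl.map_mul_self_ne_zero hxy (mul_ne_zero hx0 hy0)
  have hac := (hl.anticommute_iff hA h2 hx hy).mpr hxy
  have hxp := (hl.anticommute_iff hA h2 hx hxy).mp (hA.anticommute_self_mul hac)
  have hyp := (hl.anticommute_iff hA h2 hy hxy).mp (hA.anticommute_right_mul hac)
  have hyx := hxy
  have hpx := hxp
  have hpy := hyp
  rw [hl.map_mul_comm hA h2] at hyx hpx hpy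
  obtain ⟨c', hc', h⟩ : ∃ c', l c' = 0 ∧ associator x y c' ≠ 0 := by
    refine ⟨c - l c • (1 : A), hl.map_sub_self c, ?_⟩
    rwa [associator_sub_right, associator_smul_right, associator_one_right, smul_zero, sub_zero]
  have key : associator x y (c' - (l (x * c') / l (x * x)) • x - (l (y * c') / l (y * y)) • y -
      (l (x * y * c') / l (x * y * (x * y))) • (x * y)) ≠ 0 := by
    rwa [associator_sub_right, associator_sub_right, associator_sub_right, associator_smul_right,
      associator_smul_right, associator_smul_right, hA.flexible, (hA x y).1,
      hA.associator_self_mul_third, (hA x y).1, zero_mul, smul_zero, smul_zero, smul_zero, sub_zero,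
      sub_zero, sub_zero]
  refine ⟨x, y, _, hne key, ⟨hx, hy, ?_⟩, hxy, ?_, ?_, ?_⟩ <;>
    simp only [mul_sub, map_sub, mul_smul_comm, map_smul, smul_eq_mul, hc', hx, hy, hxy, hyx, hxp,
      hyp, hpx, hpy, div_mul_cancel₀ _ hxx, div_mul_cancel₀ _ hyy, div_mul_cancel₀ _ hpp, mul_zero,
      sub_zero, sub_self]

/-- The basis `1, x, y, z, xy, yz, zx, (xy)z` of an octonion algebra generated by three
orthogonal vectors. -/
def octonionBasis (x y z : A) : Fin 8 → A := ![1, x, y, z, x * y, y * z, z * x, x * y * z]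

theorem IsScalarPart.finrank_eq_eight (hl : IsScalarPart l) (hA : IsAlternative A)
    (h2 : (2 : F) ≠ 0) (hna : ∃ x y z : A, associator x y z ≠ 0) : Module.finrank F A = 8 := by
  obtain ⟨x, y, z, ⟨hx0, hy0, hz0⟩, ⟨hx, hy, hz⟩, hxy, hxz, hyz, hxyz⟩ :=
    hl.exists_orthogonal_triple hA h2 hna
  have iff {a b : A} (ha : l a = 0) (hb : l b = 0) := hl.anticommute_iff hA h2 ha hb
  have hzx : l (z * x) = 0 := by rwa [hl.map_mul_comm hA h2]
  have axy := (iff hx hy).mpr hxy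
  have ayz := (iff hy hz).mpr hyz
  have azx := (iff hz hx).mpr hzx
  have apz := (iff hxy hz).mpr hxyz
  have aqx := hA.anticommute_cycle axy ayz azx apz
  have ary := hA.anticommute_cycle ayz azx axy aqx
  -- `(xy)z = (yz)x = (zx)y`, so the last basis element is symmetric in the three vectors.
  have hw1 := hA.mul_mul_cycle axy azx
  have hw2 := hA.mul_mul_cycle ayz axy
  have axw := hA.anticommute_right_mul aqx
  have aqw := hA.anticommute_self_mul aqx
  have ayw := hA.anticommute_right_mul ary
  have arw := hA.anticommute_self_mul ary
  rw [← hw1] at axw aqw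
  rw [← hw2, ← hw1] at ayw arw
  let e := octonionBasis x y z
  have hlt : ∀ i j, i < j → l (e i * e j) = 0 := by
    have h01 : l (1 * x) = 0 := by rwa [one_mul]
    have h02 : l (1 * y) = 0 := by rwa [one_mul]
    have h03 : l (1 * z) = 0 := by rwa [one_mul]
    have h04 : l (1 * (x * y)) = 0 := by rwa [one_mul]
    have h05 : l (1 * (y * z)) = 0 := by rwa [one_mul]
    have h06 : l (1 * (z * x)) = 0 := by rwa [one_mul]
    have h07 : l (1 * (x * y * z)) = 0 := by rwa [one_mul]
    have h14 := (iff hx hxy).mp (hA.anticommute_self_mul axy)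
    have h15 := (iff hx hyz).mp aqx.symm
    have h16 := (iff hx hzx).mp (hA.anticommute_right_mul azx)
    have h17 := (iff hx hxyz).mp axw
    have h24 := (iff hy hxy).mp (hA.anticommute_right_mul axy)
    have h25 := (iff hy hyz).mp (hA.anticommute_self_mul ayz)
    have h26 := (iff hy hzx).mp ary.symm
    have h27 := (iff hy hxyz).mp ayw
    have h34 := (iff hz hxy).mp apz.symm
    have h35 := (iff hz hyz).mp (hA.anticommute_right_mul ayz)
    have h36 := (iff hz hzx).mp (hA.anticommute_self_mul azx)
    have h37 := (iff hz hxyz).mp (hA.anticommute_right_mul apz)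
    have h45 := (iff hxy hyz).mp (hA.anticommute_mul_mul axy ayz azx)
    have h46 := (iff hxy hzx).mp (hA.anticommute_mul_mul azx axy ayz).symm
    have h47 := (iff hxy hxyz).mp (hA.anticommute_self_mul apz)
    have h56 := (iff hyz hzx).mp (hA.anticommute_mul_mul ayz azx axy)
    have h57 := (iff hyz hxyz).mp aqw
    have h67 := (iff hzx hxyz).mp arw
    intro i j hij
    fin_cases i <;> fin_cases j <;> first | assumption | exact absurd hij (by decide)
  have horth : ∀ i j, i ≠ j → l (e i * e j) = 0 := by
    intro i j hij
    rcases lt_or_gt_of_ne hij with h | h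
    · exact hlt i j h
    · rw [hl.map_mul_comm hA h2]
      exact hlt j i h
  have hself : ∀ i, l (e i * e i) ≠ 0 := by
    intro i
    have h1 : l ((1 : A) * 1) ≠ 0 := by rw [mul_one, hl.map_one]; exact one_ne_zero
    have hxx := hl.map_mul_self_ne_zero hx hx0
    have hyy := hl.map_mul_self_ne_zero hy hy0
    have hzz := hl.map_mul_self_ne_zero hz hz0
    have hpp := hl.map_mul_self_ne_zero hxy (mul_ne_zero hx0 hy0)
    have hqq := hl.map_mul_self_ne_zero hyz (mul_ne_zero hy0 hz0)
    have hrr := hl.map_mul_self_ne_zero hzx (mul_ne_zero hz0 hx0)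
    have hww := hl.map_mul_self_ne_zero hxyz (mul_ne_zero (mul_ne_zero hx0 hy0) hz0)
    fin_cases i <;> assumption
  have hli : LinearIndependent F e :=
    LinearMap.linearIndependent_of_isOrthoᵢ (B := (LinearMap.mul F A).compr₂ l)
      (fun i j hij => horth i j hij) hself
  have hspan : ⊤ ≤ Submodule.span F (Set.range e) := by
    intro v _
    -- The remainder of `v` after its orthogonal projection onto the span vanishes.
    have hv0 : ∀ i, l (e i * (v - ∑ j, (l (e j * v) / l (e j * e j)) • e j)) = 0 := by
      intro i
      rw [mul_sub, map_sub, Finset.mul_sum, map_sum, Finset.sum_eq_single i, mul_smul_comm,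
        map_smul, smul_eq_mul, div_mul_cancel₀ _ (hself i), sub_self]
      · intro j _ hj
        rw [mul_smul_comm, map_smul, horth i j hj.symm, smul_zero]
      · intro h
        exact absurd (Finset.mem_univ i) h
    have hmem : ∑ j, (l (e j * v) / l (e j * e j)) • e j ∈ Submodule.span F (Set.range e) :=
      Submodule.sum_mem _ fun j _ =>
        Submodule.smul_mem _ _ (Submodule.subset_span ⟨j, rfl⟩)
    generalize ∑ j, (l (e j * v) / l (e j * e j)) • e j = s at hv0 hmem
    have hv : l (v - s) = 0 := by
      rw [← one_mul (v - s)]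
      exact hv0 0
    have h2' : ∀ a : A, a + a = 0 → a = 0 := fun a ha =>
      (smul_eq_zero.mp ((two_smul F a).trans ha)).resolve_left h2
    have h := hA.eq_zero_of_anticommute h2' axy ayz azx apz ((iff hx hv).mpr (hv0 1))
      ((iff hy hv).mpr (hv0 2)) ((iff hz hv).mpr (hv0 3)) ((iff hxy hv).mpr (hv0 4))
      ((iff hyz hv).mpr (hv0 5)) ((iff hzx hv).mpr (hv0 6)) ((iff hxyz hv).mpr (hv0 7))
    rw [sub_eq_zero.mp ((mul_eq_zero.mp h).resolve_left
      (mul_ne_zero (mul_ne_zero hx0 hy0) hz0))]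
    exact hmem
  rw [Module.finrank_eq_card_basis (Module.Basis.mk hli hspan), Fintype.card_fin]

end Dimension

/-- A non-associative quadratic alternative algebra without zero divisors is an octonion division
algebra. -/
theorem isOctonionDivisionAlgebra {F A : Type*} [Field F] [NonAssocRing A] [Module F A]
    [IsScalarTower F A A] [SMulCommClass F A A] [NoZeroDivisors A] [Nontrivial A]
    (hA : IsAlternative A) (h2 : (2 : F) ≠ 0) (hna : ∃ x y z : A, associator x y z ≠ 0)
    (hq : ∀ a : A, ∃ t n : F, a * a = t • a + n • (1 : A)) : IsOctonionDivisionAlgebra F A := by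
  obtain ⟨l, hl⟩ := exists_isScalarPart h2 hq
  exact
    { finrank_eq := hl.finrank_eq_eight hA h2 hna
      isComposition := hl.isCompositionAlgebra hA h2
      existsUnique_mul_left := hl.existsUnique_mul_left hA
      existsUnique_mul_right := hl.existsUnique_mul_right hA }

end IsAlternative

/-! ### The central quotient ring -/

namespace CentralQuotient

variable {R : Type*} [NonUnitalNonAssocRing R] [NoZeroDivisors R]

theorem mk_sub_mk [Nontrivial (NonUnitalSubring.center R)] (r s : R) (c : Denom R) :
    mk r c - mk s c = mk (r - s) c := by
  rw [sub_eq_add_neg, neg_mk, mk_add_mk, mk_eq_mk', cmul_denom_mul, ← map_add, sub_eq_add_neg]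

theorem associator_mk [Nontrivial (NonUnitalSubring.center R)] (r s t : R) (c d e : Denom R) :
    associator (mk r c) (mk s d) (mk t e) = mk (associator r s t) ((c.mul d).mul e) := by
  have h : c.mul (d.mul e) = (c.mul d).mul e := Subtype.ext (mul_assoc _ _ _).symm
  rw [associator_apply, mk_mul_mk, mk_mul_mk, mk_mul_mk, mk_mul_mk, h, mk_sub_mk, associator_apply]

variable [Nontrivial (NonUnitalSubring.center R)]

theorem isAlternative (hR : IsAlternative R) : IsAlternative (CentralQuotient R) := by
  intro x y
  induction x using ind with | _ r c
  induction y using ind with | _ s d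
  rw [associator_mk, associator_mk, mk_eq_zero, mk_eq_zero]
  exact hR r s

instance : NoZeroDivisors (CentralQuotient R) where
  eq_zero_or_eq_zero_of_mul_eq_zero {x y} h := by
    induction x using ind
    induction y using ind
    rw [mk_mul_mk, mk_eq_zero] at h
    rw [mk_eq_zero, mk_eq_zero]
    exact mul_eq_zero.mp h

instance : Nontrivial (CentralQuotient R) :=
  ⟨1, 0, fun h => (someDenom R).2 (Subtype.ext (mk_eq_zero.mp (one_def.symm.trans h)))⟩

theorem exists_associator_ne_zero (hna : ∃ x y z : R, associator x y z ≠ 0) :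
    ∃ x y z : CentralQuotient R, associator x y z ≠ 0 := by
  obtain ⟨x, y, z, h⟩ := hna
  refine ⟨mk x (someDenom R), mk y (someDenom R), mk z (someDenom R), ?_⟩
  rwa [associator_mk, ne_eq, mk_eq_zero]

theorem eq_zero_of_add_self_eq_zero (h2 : ∀ x : R, x + x = 0 → x = 0) (x : CentralQuotient R)
    (hx : x + x = 0) : x = 0 := by
  induction x using ind with | _ r c
  rw [mk_add_mk, mk_eq_zero, ← map_add] at hx
  rw [mk_eq_zero]
  exact h2 r (cmul_cancel c (hx.trans (map_zero _).symm))

theorem center_eq_centerFractions (hR : IsAlternative R) :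
    NonUnitalSubring.center (CentralQuotient R) = centerFractions R := by
  refine le_antisymm (fun q hq => ?_) ?_
  · induction q using ind with | _ r d
    have h := ((isAlternative hR).mem_center_iff _).mp hq
    refine ⟨⟨r, (hR.mem_center_iff r).mpr ⟨fun y z => ?_, fun x => ?_⟩⟩, d, rfl⟩
    · have h1 := h.1 (mk y d) (mk z d)
      rwa [associator_mk, mk_eq_zero] at h1
    · have h1 := h.2 (mk x d)
      rwa [mk_mul_mk, mk_mul_mk, mk_sub_mk, mk_eq_zero] at h1
  · rintro _ ⟨c, d, rfl⟩
    exact mk_mem_center c d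

theorem isOctonionDivisionAlgebra (hR : IsAlternative R)
    (hna : ∃ x y z : R, associator x y z ≠ 0) (h2 : ∀ x : R, x + x = 0 → x = 0) :
    IsOctonionDivisionAlgebra (CenterFractionField R) (CentralQuotient R) := by
  have h2' := eq_zero_of_add_self_eq_zero h2
  have hna' := exists_associator_ne_zero hna
  refine (isAlternative hR).isOctonionDivisionAlgebra ?_ hna'
    ((isAlternative hR).exists_quadratic_equation hna' h2' fun c hc => ?_)
  · intro h
    have h1 : (1 : CentralQuotient R) + 1 = 0 := by
      rw [← one_smul (CenterFractionField R) (1 : CentralQuotient R), ← add_smul,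
        one_add_one_eq_two, h, zero_smul]
    exact one_ne_zero (h2' 1 h1)
  · rw [center_eq_centerFractions hR] at hc
    exact ⟨⟨c, hc⟩, (mul_one c).symm⟩

end CentralQuotient

/-- Without zero divisors, an element of additive order two forces characteristic two. -/
theorem eq_zero_of_add_self_eq_zero_of_ringChar_ne_two {R : Type*} [NonUnitalNonAssocRing R]
    [NoZeroDivisors R] (h : nonUnitalRingChar R ≠ 2) (x : R) (hx : x + x = 0) : x = 0 := by
  by_contra h0
  have h2 : ∀ y : R, 2 • y = 0 := by
    intro y
    refine (mul_eq_zero.mp (?_ : x * 2 • y = 0)).resolve_left h0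
    rw [two_nsmul, mul_add, ← add_mul, hx, zero_mul]
  rcases (Nat.dvd_prime Nat.prime_two).mp (AddMonoid.exponent_dvd_of_forall_nsmul_eq_zero h2)
    with h1 | h1
  · have h3 := AddMonoid.exponent_nsmul_eq_zero x
    rw [h1, one_nsmul] at h3
    exact h0 h3
  · exact h h1

theorem mainTheorem1 (R : Type*) [NonUnitalNonAssocRing R] (hR : IsAlternative R)
    (hna : ∃ x y z : R, (x * y) * z ≠ x * (y * z))
    (hassoc : ∀ x y z : R, associator x y z ≠ 0 → ¬ IsZeroDivisor (associator x y z)) :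
    (∀ a : R, ¬ IsZeroDivisor a) ∧
    (nonUnitalRingChar R ≠ 2 →
      ∃ (_ : NoZeroDivisors R) (_ : Nontrivial (NonUnitalSubring.center R)),
        NonUnitalSubring.center (CentralQuotient R) = centerFractions R ∧
        IsOctonionDivisionAlgebra (CenterFractionField R) (CentralQuotient R)) := by
  have hna' : ∃ x y z : R, associator x y z ≠ 0 := by
    obtain ⟨x, y, z, h⟩ := hna
    exact ⟨x, y, z, sub_ne_zero.mpr h⟩
  have hdom : ∀ {a b : R}, a * b = 0 → a = 0 ∨ b = 0 := by
    refine hR.eq_zero_or_eq_zero_of_mul_eq_zero hna' (fun x y z b h => ?_) (fun x y z b h => ?_) <;>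
      by_contra! hne
    · exact hassoc x y z hne.1 ⟨hne.1, Or.inl ⟨b, hne.2, h⟩⟩
    · exact hassoc x y z hne.1 ⟨hne.1, Or.inr ⟨b, hne.2, h⟩⟩
  refine ⟨?_, fun hchar => ?_⟩
  · rintro a ⟨ha, ⟨b, hb, h⟩ | ⟨b, hb, h⟩⟩
    · exact (hdom h).elim ha hb
    · exact (hdom h).elim hb ha
  have : NoZeroDivisors R := ⟨hdom⟩
  have h2 := eq_zero_of_add_self_eq_zero_of_ringChar_ne_two hchar
  obtain ⟨c, hc, hc0⟩ := hR.exists_center_ne_zero hna' h2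
  have : Nontrivial (NonUnitalSubring.center R) :=
    ⟨⟨c, hc⟩, 0, fun h => hc0 (congrArg Subtype.val h)⟩
  exact ⟨inferInstance, inferInstance, CentralQuotient.center_eq_centerFractions hR,
    CentralQuotient.isOctonionDivisionAlgebra hR hna' h2⟩
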